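/- Let $\Gamma$ be a group. Rings are associative, not necessarily unital, and $\Gamma$-graded; a ring $A$ is idempotent if $A^2=A$, and torsion-free if $Ax=0$ implies $x=0$ and $xA=0$ implies $x=0$. For such a ring, $A\text{-gr}$ is the category of $\Gamma$-graded left $A$-modules $M$ that are unital ($AM=M$) and torsion-free ($Am=0$ implies $m=0$), with the degree-preserving $A$-linear maps as morphisms, and $\text{gr-}A$ is the analogous category of right modules. The suspension $M(\sigma)$ of $M$ is $M$ graded by $M(\sigma)_\tau=M_{\tau\sigma}$. $\mathrm{HOM}_A(M,N)=\bigoplus_{\sigma}\mathrm{HOM}_A(M,N)_\sigma$, where $\mathrm{HOM}_A(M,N)_\sigma$ consists of the $A$-linear $f:M\to N$ with $f(M_\tau)\subseteq N_{\tau\sigma}$ for all $\tau$; if $M$ is a graded $(A,B)$-bimodule, it is a graded left $B$-module via $(bf)(m)=f(mb)$. An object $P$ of $A\text{-gr}$ is a generator if for every $M$ in $A\text{-gr}$, every unital graded left $A$-module $N$ and every nonzero degree-preserving $A$-linear map $f:M\to N$ there are $\sigma\in\Gamma$ and a degree-preserving $A$-linear map $g:P(\sigma)\to M$ with $f\circ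 g\neq 0$. A graded functor $F:A\text{-gr}\to B\text{-gr}$ is an additive functor that commutes with all suspensions, $F(M(\sigma))=F(M)(\sigma)$ (strictly or, more generally, through natural isomorphisms $F(M(\sigma))\cong F(M)(\sigma)$ compatible with the identifications $M(e)=M$ and $M(\tau)(\sigma)=M(\sigma\tau)$). A natural graded isomorphism $\theta$ of graded functors is a natural isomorphism with $\theta_{M(\sigma)}=\theta_M(\sigma)$ for all $M$ and $\sigma$, modulo these identifications. Let $A,B$ be idempotent, torsion-free $\Gamma$-graded rings, and let $F:A\text{-gr}\to B\text{-gr}$ and $G:B\text{-gr}\to A\text{-gr}$ be inverse graded equivalences, that is, graded functors for which there are natural graded isomorphisms $GF\cong 1_{A\text{-gr}}$ and $FG\cong 1_{B\text{-gr}}$. Put $P=G(B)$ and $Q=F(A)$. For $b\in B_\sigma$ let $P\to P$, $x\mapsto xb$, be the map underlying the image under $G$ of the right multiplication by $b$, seen as a morphism $B\to B(\sigma)$; for $a\in A_\sigma$ define $Q\to Q$, $x\mapsto xa$, likewise from $F$; extend both additively. Then: 1. With these right actions, ${}_AP_B$ and ${}_BQ_A$ are graded bimodules. 2. ${}_AP\in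 A\text{-gr}$, $P_B\in\text{gr-}B$, ${}_BQ\in B\text{-gr}$, $Q_A\in\text{gr-}A$, and ${}_AP$ and ${}_BQ$ are generators of $A\text{-gr}$ and $B\text{-gr}$. 3. There are natural graded isomorphisms $G\cong A\cdot\mathrm{HOM}_B(Q,-)$ and $F\cong B\cdot\mathrm{HOM}_A(P,-)$. 4. There are graded bimodule homomorphisms $\mu:P\otimes_BQ\to A$ and $\nu:Q\otimes_AP\to B$, both surjective, such that, writing $\langle p,q\rangle=\mu(p\otimes q)$ and $[q,p]=\nu(q\otimes p)$, one has $p'[q,p]=\langle p',q\rangle p$ and $q'\langle p,q\rangle=[q',p]q$ for all $p,p'\in P$ and $q,q'\in Q$; that is, $(A,B,P,Q,\mu,\nu)$ is a graded Morita context with surjective trace maps. Moreover this context is non-degenerate: $P$ and $Q$ are torsion-free on both sides, and each of $\langle p,Q\rangle=0$, $\langle P,q\rangle=0$, $[q,P]=0$, $[Q,p]=0$ implies $p=0$, respectively $q=0$, $q=0$, $p=0$. -/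

import Mathlib

open CategoryTheory

universe v u

namespace GrMorita

/-- A `Γ`-grading on a (not necessarily unital) ring `A`: additive subgroups `A_σ` whose internal
direct sum is `A` (they are independent and span `A`) with `A_σ A_τ ⊆ A_{στ}`. -/
class GrRing (Γ : Type v) [Group Γ] (A : Type u) [NonUnitalRing A] where
  comp : Γ → AddSubgroup A
  indep : iSupIndep comp
  span : ⨆ σ, comp σ = ⊤
  mul_mem : ∀ {σ τ : Γ} {a b : A}, a ∈ comp σ → b ∈ comp τ → a * b ∈ comp (σ * τ)

/-- `A² = A`, where `A²` is the additive subgroup generated by all products. -/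
def IsIdempotentRing (A : Type u) [NonUnitalRing A] : Prop :=
  AddSubgroup.closure {x : A | ∃ a b : A, x = a * b} = ⊤

/-- A ring is torsion-free if it is torsion-free as a left and as a right module over itself. -/
def IsTorsionFreeRing (A : Type u) [NonUnitalRing A] : Prop :=
  (∀ x : A, (∀ a : A, a * x = 0) → x = 0) ∧ (∀ x : A, (∀ a : A, x * a = 0) → x = 0)

/-- A `Γ`-graded left module over the `Γ`-graded ring `A`; `smul a m` is `a m`. -/
structure GrMod (Γ : Type v) [Group Γ] (A : Type u) [NonUnitalRing A] [GrRing Γ A] where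
  carrier : Type u
  [grp : AddCommGroup carrier]
  smul : A →+ carrier →+ carrier
  mul_smul : ∀ (a b : A) (m : carrier), smul (a * b) m = smul a (smul b m)
  comp : Γ → AddSubgroup carrier
  indep : iSupIndep comp
  span : ⨆ σ, comp σ = ⊤
  smul_mem : ∀ {σ τ : Γ} {a : A} {m : carrier},
    a ∈ GrRing.comp σ → m ∈ comp τ → smul a m ∈ comp (σ * τ)

attribute [instance] GrMod.grp

variable {Γ : Type v} [Group Γ]
variable {A B C : Type u} [NonUnitalRing A] [NonUnitalRing B] [NonUnitalRing C]
variable [GrRing Γ A] [GrRing Γ B] [GrRing Γ C]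

instance : CoeSort (GrMod Γ A) (Type u) := ⟨GrMod.carrier⟩

namespace GrMod

/-- The finite sums of elements `a m`. -/
inductive IsSumSmul (M : GrMod Γ A) : M → Prop
  | zero : IsSumSmul M 0
  | smul (a : A) (m : M) : IsSumSmul M (M.smul a m)
  | add {x y : M} : IsSumSmul M x → IsSumSmul M y → IsSumSmul M (x + y)

/-- `A M`, the additive subgroup of all finite sums of elements `a m`. -/
def unitalSubgroup (M : GrMod Γ A) : AddSubgroup M where
  carrier := {x | IsSumSmul M x}
  zero_mem' := IsSumSmul.zero
  add_mem' := IsSumSmul.add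
  neg_mem' := fun {x} hx => by
    change IsSumSmul M x at hx
    change IsSumSmul M (-x)
    induction hx with
    | zero => rw [neg_zero]; exact IsSumSmul.zero
    | smul a m => rw [← map_neg]; exact IsSumSmul.smul a (-m)
    | add _ _ hx hy => rw [neg_add]; exact IsSumSmul.add hx hy

theorem unitalSubgroup_eq_closure (M : GrMod Γ A) :
    M.unitalSubgroup = AddSubgroup.closure {x : M | ∃ (a : A) (m : M), x = M.smul a m} := by
  refine le_antisymm (fun x hx => ?_) ((AddSubgroup.closure_le _).2 ?_)
  · change IsSumSmul M x at hx
    induction hx with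
    | zero => exact zero_mem _
    | smul a m => exact AddSubgroup.subset_closure ⟨a, m, rfl⟩
    | add _ _ hx hy => exact add_mem hx hy
  · rintro _ ⟨a, m, rfl⟩
    exact IsSumSmul.smul a m

/-- `A M = M`. -/
def IsUnital (M : GrMod Γ A) : Prop :=
  AddSubgroup.closure {x : M | ∃ (a : A) (m : M), x = M.smul a m} = ⊤

/-- `A m = 0` implies `m = 0`. -/
def IsTorsionFree (M : GrMod Γ A) : Prop := ∀ m : M, (∀ a : A, M.smul a m = 0) → m = 0

/-- The graded module homomorphisms (of degree `e`), as a subgroup of the additive maps. -/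
def gradedHom (M N : GrMod Γ A) : AddSubgroup (M →+ N) where
  carrier := {f | (∀ (a : A) (m : M), f (M.smul a m) = N.smul a (f m)) ∧
    ∀ (τ : Γ) (m : M), m ∈ M.comp τ → f m ∈ N.comp τ}
  zero_mem' := ⟨by simp, by simp [zero_mem]⟩
  add_mem' := fun hf hg => ⟨fun a m => by simp [hf.1, hg.1],
    fun τ m hm => add_mem (hf.2 τ m hm) (hg.2 τ m hm)⟩
  neg_mem' := fun hf => ⟨fun a m => by simp [hf.1], fun τ m hm => neg_mem (hf.2 τ m hm)⟩

/-- `HOM_A(M,N)_σ`: the `A`-linear maps `f` with `f(M_τ) ⊆ N_{τσ}` for all `τ`. -/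
def homDeg (M N : GrMod Γ A) (σ : Γ) : AddSubgroup (M →+ N) where
  carrier := {f | (∀ (a : A) (m : M), f (M.smul a m) = N.smul a (f m)) ∧
    ∀ (τ : Γ) (m : M), m ∈ M.comp τ → f m ∈ N.comp (τ * σ)}
  zero_mem' := ⟨by simp, by simp [zero_mem]⟩
  add_mem' := fun hf hg => ⟨fun a m => by simp [hf.1, hg.1],
    fun τ m hm => add_mem (hf.2 τ m hm) (hg.2 τ m hm)⟩
  neg_mem' := fun hf => ⟨fun a m => by simp [hf.1], fun τ m hm => neg_mem (hf.2 τ m hm)⟩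

/-- The finite sums of maps that are graded homomorphisms of some degree. -/
inductive IsSumHomDeg (M N : GrMod Γ A) : (M →+ N) → Prop
  | zero : IsSumHomDeg M N 0
  | deg (σ : Γ) (f : M →+ N) : f ∈ homDeg M N σ → IsSumHomDeg M N f
  | add {f g : M →+ N} : IsSumHomDeg M N f → IsSumHomDeg M N g → IsSumHomDeg M N (f + g)

/-- `HOM_A(M,N)`, the sum over all `σ` of the groups `HOM_A(M,N)_σ`. -/
def HOM (M N : GrMod Γ A) : AddSubgroup (M →+ N) where
  carrier := {f | IsSumHomDeg M N f}
  zero_mem' := IsSumHomDeg.zero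
  add_mem' := IsSumHomDeg.add
  neg_mem' := fun {f} hf => by
    change IsSumHomDeg M N f at hf
    change IsSumHomDeg M N (-f)
    induction hf with
    | zero => rw [neg_zero]; exact IsSumHomDeg.zero
    | deg σ f hf => exact IsSumHomDeg.deg σ _ (neg_mem hf)
    | add _ _ hf hg => rw [neg_add]; exact IsSumHomDeg.add hf hg

theorem HOM_eq_iSup (M N : GrMod Γ A) : HOM M N = ⨆ σ, homDeg M N σ := by
  refine le_antisymm (fun f hf => ?_) (iSup_le fun σ f hf => IsSumHomDeg.deg σ f hf)
  change IsSumHomDeg M N f at hf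
  induction hf with
  | zero => exact zero_mem _
  | deg σ f hf => exact AddSubgroup.mem_iSup_of_mem σ hf
  | add _ _ hf hg => exact add_mem hf hg

/-- The suspension `M(σ)`, with `M(σ)_τ = M_{τσ}`. -/
def susp (σ : Γ) (M : GrMod Γ A) : GrMod Γ A where
  carrier := M.carrier
  smul := M.smul
  mul_smul := M.mul_smul
  comp := fun τ => M.comp (τ * σ)
  indep := M.indep.comp (mul_left_injective σ)
  span := ((Equiv.mulRight σ).iSup_comp (g := M.comp)).trans M.span
  smul_mem := fun ha hm => by simpa only [mul_assoc] using M.smul_mem ha hm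

/-- `P` generates `M`: for every unital graded module `N` and every nonzero graded homomorphism
`f : M → N` there are `σ` and a graded homomorphism `g : P(σ) → M` with `f ∘ g ≠ 0`. -/
def Generates (P M : GrMod Γ A) : Prop :=
  ∀ N : GrMod Γ A, N.IsUnital → ∀ f ∈ gradedHom M N, f ≠ 0 →
    ∃ (σ : Γ) (g : susp σ P →+ M), g ∈ gradedHom (susp σ P) M ∧ AddMonoidHom.comp f g ≠ 0

theorem smul_mem_unitalSubgroup (M : GrMod Γ A) (a : A) (m : M) :
    M.smul a m ∈ M.unitalSubgroup :=
  IsSumSmul.smul a m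

theorem indep_addSubgroupOf {G ι : Type*} [AddCommGroup G] (H : AddSubgroup G)
    {c : ι → AddSubgroup G} (hc : iSupIndep c) :
    iSupIndep fun i => (c i).addSubgroupOf H := by
  rw [iSupIndep_def] at hc ⊢
  intro i
  rw [AddSubgroup.disjoint_def]
  intro x hx hx'
  have h2 : (x : G) ∈ ⨆ j, ⨆ (_ : j ≠ i), c j := by
    have h3 : (⨆ j, ⨆ (_ : j ≠ i), (c j).addSubgroupOf H) ≤
        (⨆ j, ⨆ (_ : j ≠ i), c j).addSubgroupOf H :=
      iSup₂_le fun j hj => AddSubgroup.comap_mono (le_iSup₂_of_le j hj le_rfl)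
    exact h3 hx'
  exact Subtype.ext (AddSubgroup.disjoint_def.1 (hc i) hx h2)

theorem span_addSubgroupOf {G ι : Type*} [AddCommGroup G] (H : AddSubgroup G)
    {c : ι → AddSubgroup G} (hc : H ≤ ⨆ i, c i ⊓ H) :
    ⨆ i, (c i).addSubgroupOf H = ⊤ := by
  apply AddSubgroup.map_injective H.subtype_injective
  rw [AddSubgroup.map_iSup]
  simp only [AddSubgroup.addSubgroupOf_map_subtype]
  rw [← AddMonoidHom.range_eq_map, AddSubgroup.range_subtype]
  exact le_antisymm (iSup_le fun i => inf_le_right) hc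

theorem unitalSubgroup_le (M : GrMod Γ A) :
    M.unitalSubgroup ≤ ⨆ σ, M.comp σ ⊓ M.unitalSubgroup := by
  conv_lhs => rw [unitalSubgroup_eq_closure]
  rw [AddSubgroup.closure_le]
  rintro x ⟨a, m, rfl⟩
  change M.smul a m ∈ ⨆ σ, M.comp σ ⊓ M.unitalSubgroup
  have ha : a ∈ ⨆ σ, GrRing.comp (Γ := Γ) (A := A) σ := by rw [GrRing.span]; trivial
  have hm : m ∈ ⨆ σ, M.comp σ := by rw [M.span]; trivial
  induction ha using AddSubgroup.iSup_induction' with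
  | h1 => simp [zero_mem]
  | hadd x y _ _ hx hy => simpa using add_mem hx hy
  | hp σ a ha =>
    induction hm using AddSubgroup.iSup_induction' with
    | h1 => simp [zero_mem]
    | hadd x y _ _ hx hy => simpa using add_mem hx hy
    | hp τ m hm =>
      exact AddSubgroup.mem_iSup_of_mem (σ * τ)
        ⟨M.smul_mem ha hm, M.smul_mem_unitalSubgroup a m⟩

/-- The graded submodule `A M` of `M`. -/
def unitalPart (M : GrMod Γ A) : GrMod Γ A where
  carrier := M.unitalSubgroup
  smul := AddMonoidHom.mk'
    (fun a => AddMonoidHom.mk'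
      (fun x => (⟨M.smul a x.1, M.smul_mem_unitalSubgroup a x.1⟩ : M.unitalSubgroup))
      (fun x y => Subtype.ext (by simp)))
    (fun a b => AddMonoidHom.ext fun x => Subtype.ext (by simp))
  mul_smul := fun a b m => Subtype.ext (M.mul_smul a b m.1)
  comp := fun σ => (M.comp σ).addSubgroupOf M.unitalSubgroup
  indep := indep_addSubgroupOf _ M.indep
  span := span_addSubgroupOf _ M.unitalSubgroup_le
  smul_mem := fun ha hm => M.smul_mem ha hm

theorem map_mem_unitalSubgroup {M N : GrMod Γ A} (φ : M →+ N)
    (hφ : ∀ (a : A) (m : M), φ (M.smul a m) = N.smul a (φ m)) {m : M}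
    (hm : m ∈ M.unitalSubgroup) : φ m ∈ N.unitalSubgroup := by
  have h : M.unitalSubgroup ≤ N.unitalSubgroup.comap φ := by
    rw [unitalSubgroup_eq_closure, AddSubgroup.closure_le]
    rintro _ ⟨a, m, rfl⟩
    change φ (M.smul a m) ∈ N.unitalSubgroup
    rw [hφ]
    exact N.smul_mem_unitalSubgroup a (φ m)
  exact h hm

theorem unitalPart_isUnital (hA : IsIdempotentRing A) (M : GrMod Γ A) :
    M.unitalPart.IsUnital := by
  have key : ∀ (a : A) (m : M),
      M.smul a m ∈ M.unitalPart.unitalSubgroup.map M.unitalSubgroup.subtype := by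
    intro a m
    have h : (⊤ : AddSubgroup A) ≤ (M.unitalPart.unitalSubgroup.map
        M.unitalSubgroup.subtype).comap (M.smul.flip m) := by
      rw [← show AddSubgroup.closure {x : A | ∃ a b : A, x = a * b} = ⊤ from hA,
        AddSubgroup.closure_le]
      rintro _ ⟨a, b, rfl⟩
      exact ⟨⟨M.smul a (M.smul b m), M.smul_mem_unitalSubgroup a _⟩,
        M.unitalPart.smul_mem_unitalSubgroup a ⟨M.smul b m, M.smul_mem_unitalSubgroup b m⟩,
        (M.mul_smul a b m).symm⟩
    exact h (AddSubgroup.mem_top a)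
  have h2 : M.unitalSubgroup ≤ M.unitalPart.unitalSubgroup.map M.unitalSubgroup.subtype := by
    conv_lhs => rw [unitalSubgroup_eq_closure]
    rw [AddSubgroup.closure_le]
    rintro _ ⟨a, m, rfl⟩
    exact key a m
  refine (unitalSubgroup_eq_closure _).symm.trans (eq_top_iff.2 fun x _ => ?_)
  obtain ⟨y, hy, hyx⟩ := h2 x.2
  have hyx' : y = x := Subtype.ext hyx
  exact hyx' ▸ hy

end GrMod

/-- A right `B`-module structure on the graded left `A`-module `M` that makes it a graded
`(A,B)`-bimodule (for the same grading); `act b m` is `m b`. -/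
structure RightStr (B : Type u) [NonUnitalRing B] [GrRing Γ B] (M : GrMod Γ A) where
  act : B →+ M →+ M
  act_mul : ∀ (b c : B) (m : M), act (b * c) m = act c (act b m)
  act_smul : ∀ (a : A) (b : B) (m : M), act b (M.smul a m) = M.smul a (act b m)
  act_mem : ∀ {σ τ : Γ} {b : B} {m : M},
    m ∈ M.comp σ → b ∈ GrRing.comp τ → act b m ∈ M.comp (σ * τ)

namespace RightStr

/-- `M B = M`. -/
def IsUnital {M : GrMod Γ A} (r : RightStr B M) : Prop :=
  AddSubgroup.closure {x : M | ∃ (b : B) (m : M), x = r.act b m} = ⊤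

/-- `m B = 0` implies `m = 0`. -/
def IsTorsionFree {M : GrMod Γ A} (r : RightStr B M) : Prop :=
  ∀ m : M, (∀ b : B, r.act b m = 0) → m = 0

end RightStr

/-! ### The graded left `B`-module `HOM_A(M,N)` for a graded `(A,B)`-bimodule `M` -/

namespace GrMod

theorem indep_homDeg (M N : GrMod Γ A) : iSupIndep (homDeg M N) := by
  rw [iSupIndep_def]
  intro σ
  rw [AddSubgroup.disjoint_def]
  intro f hf hf'
  have h0 : ∀ (ρ : Γ) (m : M), m ∈ M.comp ρ → f m = 0 := by
    intro ρ m hm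
    have h1 : f m ∈ ⨆ κ, ⨆ (_ : κ ≠ ρ * σ), N.comp κ := by
      have h2 : (⨆ τ, ⨆ (_ : τ ≠ σ), homDeg M N τ) ≤
          (⨆ κ, ⨆ (_ : κ ≠ ρ * σ), N.comp κ).comap (AddMonoidHom.eval m) :=
        iSup₂_le fun τ hτ g hg =>
          (le_iSup₂_of_le (f := fun κ (_ : κ ≠ ρ * σ) => N.comp κ) (ρ * τ)
            (fun h => hτ (mul_left_cancel h)) le_rfl) (hg.2 ρ m hm)
      exact h2 hf'
    exact AddSubgroup.disjoint_def.1 (iSupIndep_def.1 N.indep (ρ * σ)) (hf.2 ρ m hm) h1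
  ext m
  have hm : m ∈ ⨆ σ, M.comp σ := by rw [M.span]; trivial
  induction hm using AddSubgroup.iSup_induction' with
  | h1 => simp
  | hadd x y _ _ hx hy => simpa using by rw [hx, hy]; simp
  | hp ρ m hm => simpa using h0 ρ m hm

theorem homDeg_comp_act {M : GrMod Γ A} (r : RightStr B M) (N : GrMod Γ A) {ρ σ : Γ} {b : B}
    (hb : b ∈ GrRing.comp ρ) {f : M →+ N} (hf : f ∈ homDeg M N σ) :
    f.comp (r.act b) ∈ homDeg M N (ρ * σ) :=
  ⟨fun a m => by simp [r.act_smul, hf.1],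
    fun τ m hm => by
      rw [← mul_assoc]; exact hf.2 _ _ (r.act_mem hm hb)⟩

theorem HOM_comp_act {M : GrMod Γ A} (r : RightStr B M) (N : GrMod Γ A) (b : B) {f : M →+ N}
    (hf : f ∈ HOM M N) : f.comp (r.act b) ∈ HOM M N := by
  have hb : b ∈ ⨆ σ, GrRing.comp (Γ := Γ) (A := B) σ := by rw [GrRing.span]; trivial
  induction hb using AddSubgroup.iSup_induction' with
  | h1 => simp [zero_mem]
  | hadd x y _ _ hx hy => simpa [AddMonoidHom.comp_add] using add_mem hx hy
  | hp ρ b hb =>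
    rw [HOM_eq_iSup] at hf
    induction hf using AddSubgroup.iSup_induction' with
    | h1 => simp [zero_mem]
    | hadd x y _ _ hx hy => simpa [AddMonoidHom.add_comp] using add_mem hx hy
    | hp σ f hf => exact IsSumHomDeg.deg (ρ * σ) _ (homDeg_comp_act r N hb hf)

/-- `HOM_A(M,N)` as a graded left `B`-module: `(b f)(m) = f(m b)`. -/
def homModule {M : GrMod Γ A} (r : RightStr B M) (N : GrMod Γ A) : GrMod Γ B where
  carrier := HOM M N
  smul := AddMonoidHom.mk'
    (fun b => AddMonoidHom.mk'
      (fun f => (⟨f.1.comp (r.act b), HOM_comp_act r N b f.2⟩ : HOM M N))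
      (fun f g => Subtype.ext (AddMonoidHom.add_comp _ _ _)))
    (fun b c => AddMonoidHom.ext fun f => Subtype.ext (by simp [AddMonoidHom.comp_add]))
  mul_smul := fun b c f => Subtype.ext (AddMonoidHom.ext fun m => by
    change f.1 (r.act (b * c) m) = f.1 (r.act c (r.act b m))
    rw [r.act_mul])
  comp := fun σ => (homDeg M N σ).addSubgroupOf (HOM M N)
  indep := indep_addSubgroupOf _ (indep_homDeg M N)
  span := span_addSubgroupOf _ (by
    have h : ∀ σ, homDeg M N σ ⊓ HOM M N = homDeg M N σ :=
      fun σ => inf_eq_left.2 fun f hf => IsSumHomDeg.deg σ f hf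
    simp only [h]
    exact (HOM_eq_iSup M N).le)
  smul_mem := fun hb hf => homDeg_comp_act r N hb hf

theorem unitalPart_homModule_isTorsionFree {M : GrMod Γ A} {r : RightStr B M}
    (hr : r.IsUnital) (N : GrMod Γ A) : (homModule r N).unitalPart.IsTorsionFree := by
  rintro ⟨⟨f, hf⟩, hf'⟩ h
  refine Subtype.ext (Subtype.ext (AddMonoidHom.ext fun m => ?_))
  change f m = 0
  have hm : m ∈ AddSubgroup.closure {x : M | ∃ (b : B) (m : M), x = r.act b m} := by
    rw [show AddSubgroup.closure {x : M | ∃ (b : B) (m : M), x = r.act b m} = ⊤ from hr]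
    trivial
  induction hm using AddSubgroup.closure_induction with
  | mem x hx =>
    obtain ⟨b, m, rfl⟩ := hx
    exact DFunLike.congr_fun (congrArg (fun g => g.1.1) (h b)) m
  | zero => simp
  | add x y _ _ hx hy => simp [hx, hy]
  | neg x _ hx => simp [hx]

end GrMod

/-! ### The category `A-gr` -/

/-- The objects of `A-gr`: unital torsion-free graded left `A`-modules. -/
structure UTMod (Γ : Type v) [Group Γ] (A : Type u) [NonUnitalRing A] [GrRing Γ A]
    extends GrMod Γ A where
  unital : toGrMod.IsUnital
  torsionFree : toGrMod.IsTorsionFree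

instance : CoeSort (UTMod Γ A) (Type u) := ⟨fun M => M.toGrMod.carrier⟩

namespace UTMod

instance : Category (UTMod Γ A) where
  Hom M N := GrMod.gradedHom M.toGrMod N.toGrMod
  id M := ⟨AddMonoidHom.id M, fun _ _ => rfl, fun _ _ h => h⟩
  comp f g := ⟨g.1.comp f.1, fun a m => by
      rw [AddMonoidHom.comp_apply, AddMonoidHom.comp_apply, f.2.1, g.2.1],
    fun τ m hm => g.2.2 τ _ (f.2.2 τ m hm)⟩

/-- The additive map underlying a morphism of `A-gr`. -/
def app {M N : UTMod Γ A} (f : M ⟶ N) : M →+ N := f.1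

/-- The morphism of `A-gr` given by a graded homomorphism. -/
def mkHom {M N : UTMod Γ A} (f : M →+ N)
    (h : f ∈ GrMod.gradedHom M.toGrMod N.toGrMod) : M ⟶ N := ⟨f, h⟩

@[simp] theorem app_mkHom {M N : UTMod Γ A} (f : M →+ N)
    (h : f ∈ GrMod.gradedHom M.toGrMod N.toGrMod) : app (mkHom f h) = f := rfl

@[simp] theorem app_id (M : UTMod Γ A) : app (𝟙 M) = AddMonoidHom.id M := rfl

@[simp] theorem app_comp {M N K : UTMod Γ A} (f : M ⟶ N) (g : N ⟶ K) :
    app (f ≫ g) = (app g).comp (app f) := rfl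

@[ext] theorem hom_ext {M N : UTMod Γ A} {f g : M ⟶ N} (h : ∀ m, app f m = app g m) : f = g :=
  Subtype.ext (AddMonoidHom.ext h)

instance : Preadditive (UTMod Γ A) where
  homGroup M N := inferInstanceAs (AddCommGroup (GrMod.gradedHom M.toGrMod N.toGrMod))
  add_comp _ _ _ _ _ g := hom_ext fun _ => map_add g.1 _ _
  comp_add _ _ _ _ _ _ := rfl

/-- The suspension functor `T_σ`: `M ↦ M(σ)`, and trivial on morphisms. -/
def susp (σ : Γ) : UTMod Γ A ⥤ UTMod Γ A where
  obj M := ⟨M.toGrMod.susp σ, M.unital, M.torsionFree⟩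
  map {M N} f := mkHom (M := ⟨M.toGrMod.susp σ, M.unital, M.torsionFree⟩)
    (N := ⟨N.toGrMod.susp σ, N.unital, N.torsionFree⟩) (app (M := M) (N := N) f)
    ⟨f.2.1, fun _ m hm => f.2.2 _ m hm⟩

/-- The identity map `M(1) → M`. -/
def suspOne : susp (1 : Γ) ≅ 𝟭 (UTMod Γ A) :=
  NatIso.ofComponents
    (fun M =>
      { hom := mkHom (M := (susp 1).obj M) (N := M) (AddMonoidHom.id M)
          ⟨fun _ _ => rfl, fun τ m hm => by
            change m ∈ M.comp (τ * 1) at hm; rwa [mul_one] at hm⟩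
        inv := mkHom (M := M) (N := (susp 1).obj M) (AddMonoidHom.id M)
          ⟨fun _ _ => rfl, fun τ m hm => by
            change m ∈ M.comp (τ * 1); rwa [mul_one]⟩
        hom_inv_id := rfl
        inv_hom_id := rfl })
    (fun _ => rfl)

/-- The identity map `M(τ)(σ) → M(στ)`. -/
def suspMul (σ τ : Γ) : susp τ ⋙ susp σ ≅ (susp (σ * τ) : UTMod Γ A ⥤ UTMod Γ A) :=
  NatIso.ofComponents
    (fun M =>
      { hom := mkHom (M := (susp σ).obj ((susp τ).obj M)) (N := (susp (σ * τ)).obj M)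
          (AddMonoidHom.id M) ⟨fun _ _ => rfl, fun ρ m hm => by
            change m ∈ M.comp (ρ * σ * τ) at hm
            change m ∈ M.comp (ρ * (σ * τ))
            rwa [← mul_assoc]⟩
        inv := mkHom (M := (susp (σ * τ)).obj M) (N := (susp σ).obj ((susp τ).obj M))
          (AddMonoidHom.id M) ⟨fun _ _ => rfl, fun ρ m hm => by
            change m ∈ M.comp (ρ * (σ * τ)) at hm
            change m ∈ M.comp (ρ * σ * τ)
            rwa [mul_assoc]⟩
        hom_inv_id := rfl
        inv_hom_id := rfl })
    (fun _ => rfl)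

end UTMod

/-! ### Graded functors -/

/-- A graded functor `A-gr → B-gr`: an additive functor that commutes with the suspension functors.
Commutation is expressed by natural isomorphisms `F(M(σ)) ≅ F(M)(σ)`, compatible with
the identifications `M(1) = M` and `M(τ)(σ) = M(στ)`. A functor with `F ∘ T_σ = T_σ ∘ F` for
all `σ` is the special case `GradedFunctor.ofEq`. -/
structure GradedFunctor (Γ : Type v) [Group Γ] (A B : Type u) [NonUnitalRing A] [NonUnitalRing B]
    [GrRing Γ A] [GrRing Γ B] where
  toFunctor : UTMod Γ A ⥤ UTMod Γ B
  additive : toFunctor.Additive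
  comm : ∀ σ : Γ, UTMod.susp σ ⋙ toFunctor ≅ toFunctor ⋙ UTMod.susp σ
  comm_one : ∀ M : UTMod Γ A,
    (comm 1).hom.app M ≫ UTMod.suspOne.hom.app (toFunctor.obj M) =
      toFunctor.map (UTMod.suspOne.hom.app M)
  comm_mul : ∀ (σ τ : Γ) (M : UTMod Γ A),
    toFunctor.map ((UTMod.suspMul σ τ).hom.app M) ≫ (comm (σ * τ)).hom.app M =
      (comm σ).hom.app ((UTMod.susp τ).obj M) ≫ (UTMod.susp σ).map ((comm τ).hom.app M) ≫
        (UTMod.suspMul σ τ).hom.app (toFunctor.obj M)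

namespace GradedFunctor

theorem eq_eqToHom {M N : UTMod Γ A} (h : M = N) (f : M ⟶ N)
    (hf : ∀ m : M, HEq (UTMod.app f m) m) : f = eqToHom h := by
  subst h
  exact UTMod.hom_ext fun m => eq_of_heq (hf m)

theorem susp_one_obj (M : UTMod Γ A) : (UTMod.susp 1).obj M = M := by
  obtain ⟨⟨c, s, ms, co, i, sp, sm⟩, hu, ht⟩ := M
  simp [UTMod.susp, GrMod.susp]

theorem susp_mul_obj (σ τ : Γ) (M : UTMod Γ A) :
    (UTMod.susp σ).obj ((UTMod.susp τ).obj M) = (UTMod.susp (σ * τ)).obj M := by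
  simp [UTMod.susp, GrMod.susp, mul_assoc]

/-- A functor that commutes strictly with all suspensions is a graded functor. -/
def ofEq (F : UTMod Γ A ⥤ UTMod Γ B) (hF : F.Additive)
    (h : ∀ σ : Γ, UTMod.susp σ ⋙ F = F ⋙ UTMod.susp σ) : GradedFunctor Γ A B where
  toFunctor := F
  additive := hF
  comm := fun σ => eqToIso (h σ)
  comm_one := fun M => by
    rw [eq_eqToHom (susp_one_obj M) (UTMod.suspOne.hom.app M) (fun _ => HEq.rfl),
      eq_eqToHom (susp_one_obj (F.obj M)) (UTMod.suspOne.hom.app (F.obj M)) (fun _ => HEq.rfl)]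
    simp [eqToHom_map]
  comm_mul := fun σ τ M => by
    rw [eq_eqToHom (susp_mul_obj σ τ M) ((UTMod.suspMul σ τ).hom.app M) (fun _ => HEq.rfl),
      eq_eqToHom (susp_mul_obj σ τ (F.obj M)) ((UTMod.suspMul σ τ).hom.app (F.obj M))
        (fun _ => HEq.rfl)]
    simp [eqToHom_map]

/-- The identity of `A-gr`. -/
def id (Γ : Type v) [Group Γ] (A : Type u) [NonUnitalRing A] [GrRing Γ A] :
    GradedFunctor Γ A A where
  toFunctor := 𝟭 _
  additive := inferInstance
  comm := fun σ => Iso.refl _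
  comm_one := fun M => by simp
  comm_mul := fun σ τ M => by simp

/-- The composition of graded functors, first `F`, then `G`. -/
def comp (F : GradedFunctor Γ A B) (G : GradedFunctor Γ B C) : GradedFunctor Γ A C where
  toFunctor := F.toFunctor ⋙ G.toFunctor
  additive := by
    have := F.additive
    have := G.additive
    infer_instance
  comm := fun σ => NatIso.ofComponents
    (fun M => G.toFunctor.mapIso ((F.comm σ).app M) ≪≫ (G.comm σ).app (F.toFunctor.obj M))
    (fun {M N} f => by
      have h1 := (F.comm σ).hom.naturality f
      have h2 := (G.comm σ).hom.naturality (F.toFunctor.map f)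
      simp only [Functor.comp_obj, Functor.comp_map] at h1 h2
      simp only [Functor.comp_obj, Functor.comp_map, Iso.trans_hom, Functor.mapIso_hom,
        Iso.app_hom, Category.assoc]
      rw [← h2, ← Functor.map_comp_assoc, ← Functor.map_comp_assoc, h1])
  comm_one := fun M => by
    have h1 := F.comm_one M
    have h2 := G.comm_one (F.toFunctor.obj M)
    simp only [NatIso.ofComponents_hom_app, Iso.trans_hom, Functor.mapIso_hom, Iso.app_hom,
      Functor.comp_obj, Functor.comp_map, Category.assoc]
    rw [← h1, Functor.map_comp]
    erw [h2]
  comm_mul := fun σ τ M => by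
    have h1 := F.comm_mul σ τ M
    have h2 := G.comm_mul σ τ (F.toFunctor.obj M)
    have h3 := (G.comm σ).hom.naturality ((F.comm τ).hom.app M)
    simp only [Functor.comp_obj, Functor.comp_map] at h1 h2 h3
    simp only [NatIso.ofComponents_hom_app, Iso.trans_hom, Functor.mapIso_hom, Iso.app_hom,
      Functor.comp_obj, Functor.comp_map, Category.assoc, Functor.map_comp]
    rw [← Functor.map_comp_assoc, h1, Functor.map_comp, Functor.map_comp, Category.assoc,
      Category.assoc, h2]
    rw [reassoc_of% h3]

end GradedFunctor

/-- A natural graded isomorphism between graded functors: a natural isomorphism of functors that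
commutes with suspension, i.e. `θ_{M(σ)} = θ_M(σ)` up to the identifications `F(M(σ)) ≅ F(M)(σ)`. -/
structure GradedNatIso (F F' : GradedFunctor Γ A B) where
  iso : F.toFunctor ≅ F'.toFunctor
  comm_susp : ∀ (σ : Γ) (M : UTMod Γ A),
    iso.hom.app ((UTMod.susp σ).obj M) ≫ (F'.comm σ).hom.app M =
      (F.comm σ).hom.app M ≫ (UTMod.susp σ).map (iso.hom.app M)

/-! ### The functor `B · HOM_A(M,-) : A-gr → B-gr` -/

namespace GrMod

theorem comp_mem_homDeg {M N N' : GrMod Γ A} {f : N →+ N'} (hf : f ∈ gradedHom N N') {σ : Γ}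
    {g : M →+ N} (hg : g ∈ homDeg M N σ) : f.comp g ∈ homDeg M N' σ :=
  ⟨fun a m => by rw [AddMonoidHom.comp_apply, AddMonoidHom.comp_apply, hg.1, hf.1],
    fun τ m hm => hf.2 _ _ (hg.2 τ m hm)⟩

theorem comp_mem_HOM {M N N' : GrMod Γ A} {f : N →+ N'} (hf : f ∈ gradedHom N N')
    {g : M →+ N} (hg : g ∈ HOM M N) : f.comp g ∈ HOM M N' := by
  rw [HOM_eq_iSup] at hg
  induction hg using AddSubgroup.iSup_induction' with
  | h1 => simp [zero_mem]
  | hadd x y _ _ hx hy => simpa [AddMonoidHom.comp_add] using add_mem hx hy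
  | hp σ g hg => exact IsSumHomDeg.deg σ _ (comp_mem_homDeg hf hg)

theorem comp_mem_unitalSubgroup {M N N' : GrMod Γ A} (r : RightStr B M) {f : N →+ N'}
    (hf : f ∈ gradedHom N N') {g : HOM M N} (hg : g ∈ (homModule r N).unitalSubgroup) :
    (⟨f.comp g.1, comp_mem_HOM hf g.2⟩ : HOM M N') ∈ (homModule r N').unitalSubgroup :=
  map_mem_unitalSubgroup (M := homModule r N) (N := homModule r N')
    (AddMonoidHom.mk' (fun g : HOM M N => (⟨f.comp g.1, comp_mem_HOM hf g.2⟩ : HOM M N'))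
      (fun _ _ => Subtype.ext (AddMonoidHom.comp_add _ _ _)))
    (fun _ _ => rfl) hg

theorem homDeg_susp (M N : GrMod Γ A) (σ τ : Γ) :
    homDeg M (susp σ N) τ = homDeg M N (τ * σ) := by
  have h : ∀ f : M →+ N, f ∈ homDeg M (susp σ N) τ ↔ f ∈ homDeg M N (τ * σ) := fun f =>
    and_congr Iff.rfl (forall₃_congr fun ρ m _ => by
      change f m ∈ N.comp (ρ * τ * σ) ↔ _
      rw [mul_assoc])
  exact AddSubgroup.ext h

theorem HOM_susp (M N : GrMod Γ A) (σ : Γ) : HOM M (susp σ N) = HOM M N := by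
  have h : HOM M (susp σ N) = ⨆ τ, homDeg M N (τ * σ) :=
    (HOM_eq_iSup M (susp σ N)).trans (iSup_congr (homDeg_susp M N σ))
  exact h.trans (((Equiv.mulRight σ).iSup_comp (g := homDeg M N)).trans (HOM_eq_iSup M N).symm)

theorem homModule_smul_apply {M : GrMod Γ A} (r : RightStr B M) (N : GrMod Γ A) (b : B)
    (g : HOM M N) (m : M) :
    (show HOM M N from (homModule r N).smul b g).1 m = g.1 (r.act b m) := rfl

/-- The identity map `HOM_A(M,N(σ)) → HOM_A(M,N)`. -/
def HOMSusp (M N : GrMod Γ A) (σ : Γ) : HOM M (susp σ N) →+ HOM M N :=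
  AddMonoidHom.mk' (fun g => ⟨g.1, (HOM_susp M N σ).le g.2⟩) (fun _ _ => rfl)

theorem HOMSusp_apply (M N : GrMod Γ A) (σ : Γ) (g : HOM M (susp σ N)) (m : M) :
    (HOMSusp M N σ g).1 m = g.1 m := rfl

/-- The identity map `HOM_A(M,N) → HOM_A(M,N(σ))`. -/
def HOMSuspInv (M N : GrMod Γ A) (σ : Γ) : HOM M N →+ HOM M (susp σ N) :=
  AddMonoidHom.mk' (fun g => ⟨g.1, (HOM_susp M N σ).ge g.2⟩) (fun _ _ => rfl)

theorem HOMSuspInv_apply (M N : GrMod Γ A) (σ : Γ) (g : HOM M N) (m : M) :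
    (HOMSuspInv M N σ g).1 m = g.1 m := rfl

theorem HOMSusp_smul {M : GrMod Γ A} (r : RightStr B M) (N : GrMod Γ A) (σ : Γ) (b : B)
    (g : HOM M (susp σ N)) :
    HOMSusp M N σ ((homModule r (susp σ N)).smul b g) =
      (homModule r N).smul b (HOMSusp M N σ g) := by
  refine Subtype.ext (AddMonoidHom.ext fun m => ?_)
  exact (HOMSusp_apply M N σ _ m).trans ((homModule_smul_apply r (susp σ N) b g m).trans
    ((homModule_smul_apply r N b (HOMSusp M N σ g) m).trans (HOMSusp_apply M N σ g _)).symm)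

theorem HOMSuspInv_smul {M : GrMod Γ A} (r : RightStr B M) (N : GrMod Γ A) (σ : Γ) (b : B)
    (g : HOM M N) :
    HOMSuspInv M N σ ((homModule r N).smul b g) =
      (homModule r (susp σ N)).smul b (HOMSuspInv M N σ g) := by
  refine Subtype.ext (AddMonoidHom.ext fun m => ?_)
  exact (HOMSuspInv_apply M N σ _ m).trans ((homModule_smul_apply r N b g m).trans
    ((homModule_smul_apply r (susp σ N) b (HOMSuspInv M N σ g) m).trans
      (HOMSuspInv_apply M N σ g _)).symm)

theorem HOMSusp_mem {M : GrMod Γ A} (r : RightStr B M) (N : GrMod Γ A) (σ : Γ)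
    {g : HOM M (susp σ N)} (hg : g ∈ (homModule r (susp σ N)).unitalSubgroup) :
    HOMSusp M N σ g ∈ (homModule r N).unitalSubgroup :=
  map_mem_unitalSubgroup (M := homModule r (susp σ N)) (N := homModule r N) (HOMSusp M N σ)
    (HOMSusp_smul r N σ) hg

theorem HOMSuspInv_mem {M : GrMod Γ A} (r : RightStr B M) (N : GrMod Γ A) (σ : Γ)
    {g : HOM M N} (hg : g ∈ (homModule r N).unitalSubgroup) :
    HOMSuspInv M N σ g ∈ (homModule r (susp σ N)).unitalSubgroup :=
  map_mem_unitalSubgroup (M := homModule r N) (N := homModule r (susp σ N)) (HOMSuspInv M N σ)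
    (HOMSuspInv_smul r N σ) hg

end GrMod

/-- The object `B · HOM_A(M,N)` of `B-gr`. -/
def homObj (hB : IsIdempotentRing B) {M : GrMod Γ A} (r : RightStr B M) (hr : r.IsUnital)
    (N : GrMod Γ A) : UTMod Γ B where
  toGrMod := (GrMod.homModule r N).unitalPart
  unital := GrMod.unitalPart_isUnital hB _
  torsionFree := GrMod.unitalPart_homModule_isTorsionFree hr N

/-- Composition with a morphism `f : N → N'`, as a morphism `B · HOM_A(M,N) → B · HOM_A(M,N')`. -/
def homMap (hB : IsIdempotentRing B) {M : GrMod Γ A} (r : RightStr B M) (hr : r.IsUnital)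
    {N N' : UTMod Γ A} (f : N ⟶ N') :
    homObj hB r hr N.toGrMod ⟶ homObj hB r hr N'.toGrMod :=
  UTMod.mkHom (M := homObj hB r hr N.toGrMod) (N := homObj hB r hr N'.toGrMod)
    (AddMonoidHom.mk'
      (fun x => (⟨⟨(UTMod.app f).comp x.1.1, GrMod.comp_mem_HOM f.2 x.1.2⟩,
        GrMod.comp_mem_unitalSubgroup r f.2 x.2⟩ :
          (GrMod.homModule r N'.toGrMod).unitalSubgroup))
      (fun _ _ => Subtype.ext (Subtype.ext (AddMonoidHom.comp_add _ _ _))))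
    ⟨fun _ _ => rfl, fun _ _ hm => GrMod.comp_mem_homDeg f.2 hm⟩

/-- The additive map `M → N` underlying an element of `B · HOM_A(M,N)`. -/
def homVal {hB : IsIdempotentRing B} {M : GrMod Γ A} {r : RightStr B M} {hr : r.IsUnital}
    {N : GrMod Γ A} (x : homObj hB r hr N) : M →+ N := x.1.1

theorem homVal_ext {hB : IsIdempotentRing B} {M : GrMod Γ A} {r : RightStr B M}
    {hr : r.IsUnital} {N : GrMod Γ A} {x y : homObj hB r hr N}
    (h : ∀ m : M, homVal x m = homVal y m) : x = y :=
  Subtype.ext (Subtype.ext (AddMonoidHom.ext h))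

theorem homVal_homMap (hB : IsIdempotentRing B) {M : GrMod Γ A} (r : RightStr B M)
    (hr : r.IsUnital) {N N' : UTMod Γ A} (f : N ⟶ N') (x : homObj hB r hr N.toGrMod) (m : M) :
    homVal (UTMod.app (homMap hB r hr f) x) m = UTMod.app f (homVal x m) := rfl

/-- The identity map `B · HOM_A(M,N(σ)) → (B · HOM_A(M,N))(σ)`. -/
def homSusp (hB : IsIdempotentRing B) {M : GrMod Γ A} (r : RightStr B M) (hr : r.IsUnital)
    (σ : Γ) (N : UTMod Γ A) :
    homObj hB r hr ((UTMod.susp σ).obj N).toGrMod ⟶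
      (UTMod.susp σ).obj (homObj hB r hr N.toGrMod) :=
  UTMod.mkHom (M := homObj hB r hr ((UTMod.susp σ).obj N).toGrMod)
    (N := (UTMod.susp σ).obj (homObj hB r hr N.toGrMod))
    (AddMonoidHom.mk'
      (fun x => (⟨GrMod.HOMSusp M N.toGrMod σ x.1, GrMod.HOMSusp_mem r N.toGrMod σ x.2⟩ :
          (GrMod.homModule r N.toGrMod).unitalSubgroup))
      (fun x y => Subtype.ext (map_add (GrMod.HOMSusp M N.toGrMod σ) x.1 y.1)))
    ⟨fun b x => Subtype.ext (GrMod.HOMSusp_smul r N.toGrMod σ b x.1),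
      fun τ _ hm => (GrMod.homDeg_susp M N.toGrMod σ τ).le hm⟩

theorem homVal_homSusp (hB : IsIdempotentRing B) {M : GrMod Γ A} (r : RightStr B M)
    (hr : r.IsUnital) (σ : Γ) (N : UTMod Γ A)
    (x : homObj hB r hr ((UTMod.susp σ).obj N).toGrMod) (m : M) :
    homVal (N := N.toGrMod) (hB := hB) (r := r) (hr := hr)
      (UTMod.app (homSusp hB r hr σ N) x) m = homVal x m :=
  GrMod.HOMSusp_apply M N.toGrMod σ x.1 m

/-- The identity map `(B · HOM_A(M,N))(σ) → B · HOM_A(M,N(σ))`. -/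
def homSuspInv (hB : IsIdempotentRing B) {M : GrMod Γ A} (r : RightStr B M) (hr : r.IsUnital)
    (σ : Γ) (N : UTMod Γ A) :
    (UTMod.susp σ).obj (homObj hB r hr N.toGrMod) ⟶
      homObj hB r hr ((UTMod.susp σ).obj N).toGrMod :=
  UTMod.mkHom (M := (UTMod.susp σ).obj (homObj hB r hr N.toGrMod))
    (N := homObj hB r hr ((UTMod.susp σ).obj N).toGrMod)
    (AddMonoidHom.mk'
      (fun x => (⟨GrMod.HOMSuspInv M N.toGrMod σ x.1, GrMod.HOMSuspInv_mem r N.toGrMod σ x.2⟩ :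
          (GrMod.homModule r (N.toGrMod.susp σ)).unitalSubgroup))
      (fun x y => Subtype.ext (map_add (GrMod.HOMSuspInv M N.toGrMod σ) x.1 y.1)))
    ⟨fun b x => Subtype.ext (GrMod.HOMSuspInv_smul r N.toGrMod σ b x.1),
      fun τ _ hm => (GrMod.homDeg_susp M N.toGrMod σ τ).ge hm⟩

theorem homVal_homSuspInv (hB : IsIdempotentRing B) {M : GrMod Γ A} (r : RightStr B M)
    (hr : r.IsUnital) (σ : Γ) (N : UTMod Γ A) (x : homObj hB r hr N.toGrMod) (m : M) :
    homVal (UTMod.app (homSuspInv hB r hr σ N) x) m = homVal x m :=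
  GrMod.HOMSuspInv_apply M N.toGrMod σ x.1 m

theorem homSusp_homSuspInv (hB : IsIdempotentRing B) {M : GrMod Γ A} (r : RightStr B M)
    (hr : r.IsUnital) (σ : Γ) (N : UTMod Γ A) :
    homSusp hB r hr σ N ≫ homSuspInv hB r hr σ N = 𝟙 _ :=
  UTMod.hom_ext fun x => homVal_ext fun m =>
    (homVal_homSuspInv hB r hr σ N (UTMod.app (homSusp hB r hr σ N) x) m).trans
      (homVal_homSusp hB r hr σ N x m)

theorem homSuspInv_homSusp (hB : IsIdempotentRing B) {M : GrMod Γ A} (r : RightStr B M)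
    (hr : r.IsUnital) (σ : Γ) (N : UTMod Γ A) :
    homSuspInv hB r hr σ N ≫ homSusp hB r hr σ N = 𝟙 _ :=
  UTMod.hom_ext fun x => homVal_ext (N := N.toGrMod) fun m =>
    (homVal_homSusp hB r hr σ N (UTMod.app (homSuspInv hB r hr σ N) x) m).trans
      (homVal_homSuspInv hB r hr σ N x m)

theorem homMap_homSusp (hB : IsIdempotentRing B) {M : GrMod Γ A} (r : RightStr B M)
    (hr : r.IsUnital) (σ : Γ) {N N' : UTMod Γ A} (f : N ⟶ N') :
    homMap hB r hr ((UTMod.susp σ).map f) ≫ homSusp hB r hr σ N' =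
      homSusp hB r hr σ N ≫ (UTMod.susp σ).map (homMap hB r hr f) :=
  UTMod.hom_ext fun x => homVal_ext (N := N'.toGrMod) fun m =>
    (homVal_homSusp hB r hr σ N'
      (UTMod.app (homMap hB r hr ((UTMod.susp σ).map f)) x) m).trans
      ((homVal_homMap hB r hr ((UTMod.susp σ).map f) x m).trans
        ((homVal_homMap hB r hr f (UTMod.app (homSusp hB r hr σ N) x) m).trans
          (congrArg (UTMod.app f) (homVal_homSusp hB r hr σ N x m))).symm)

theorem homSusp_one (hB : IsIdempotentRing B) {M : GrMod Γ A} (r : RightStr B M)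
    (hr : r.IsUnital) (N : UTMod Γ A) :
    homSusp hB r hr 1 N ≫ UTMod.suspOne.hom.app (homObj hB r hr N.toGrMod) =
      homMap hB r hr (UTMod.suspOne.hom.app N) :=
  UTMod.hom_ext fun x => homVal_ext (N := N.toGrMod) fun m =>
    (homVal_homSusp hB r hr 1 N x m).trans
      (homVal_homMap hB r hr (UTMod.suspOne.hom.app N) x m).symm

theorem homSusp_mul (hB : IsIdempotentRing B) {M : GrMod Γ A} (r : RightStr B M)
    (hr : r.IsUnital) (σ τ : Γ) (N : UTMod Γ A) :
    homMap hB r hr ((UTMod.suspMul σ τ).hom.app N) ≫ homSusp hB r hr (σ * τ) N =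
      homSusp hB r hr σ ((UTMod.susp τ).obj N) ≫ (UTMod.susp σ).map (homSusp hB r hr τ N) ≫
        (UTMod.suspMul σ τ).hom.app (homObj hB r hr N.toGrMod) :=
  UTMod.hom_ext fun x => homVal_ext (N := N.toGrMod) fun m =>
    ((homVal_homSusp hB r hr (σ * τ) N
      (UTMod.app (homMap hB r hr ((UTMod.suspMul σ τ).hom.app N)) x) m).trans
      (homVal_homMap hB r hr ((UTMod.suspMul σ τ).hom.app N) x m)).trans
      ((homVal_homSusp hB r hr τ N
        (UTMod.app (homSusp hB r hr σ ((UTMod.susp τ).obj N)) x) m).trans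
        (homVal_homSusp hB r hr σ ((UTMod.susp τ).obj N) x m)).symm

/-- The graded functor `B · HOM_A(M,-) : A-gr → B-gr`. -/
def homFunctor (hB : IsIdempotentRing B) {M : GrMod Γ A} (r : RightStr B M) (hr : r.IsUnital) :
    GradedFunctor Γ A B where
  toFunctor :=
    { obj := fun N => homObj hB r hr N.toGrMod
      map := fun f => homMap hB r hr f
      map_id := fun _ => rfl
      map_comp := fun _ _ => rfl }
  additive := ⟨fun {_ _ f g} => UTMod.hom_ext fun x =>
    Subtype.ext (Subtype.ext (AddMonoidHom.add_comp f.1 g.1 x.1.1))⟩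
  comm := fun σ => NatIso.ofComponents
    (fun N =>
      { hom := homSusp hB r hr σ N
        inv := homSuspInv hB r hr σ N
        hom_inv_id := homSusp_homSuspInv hB r hr σ N
        inv_hom_id := homSuspInv_homSusp hB r hr σ N })
    (fun f => homMap_homSusp hB r hr σ f)
  comm_one := fun N => homSusp_one hB r hr N
  comm_mul := fun σ τ N => homSusp_mul hB r hr σ τ N

/-! ### `A` as an object of `A-gr`, and the right actions on `F(A)` -/

/-- `A` as a graded left module over itself. -/
def GrMod.self (Γ : Type v) [Group Γ] (A : Type u) [NonUnitalRing A] [GrRing Γ A] :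
    GrMod Γ A where
  carrier := A
  smul := AddMonoidHom.mul
  mul_smul := fun a b m => mul_assoc a b m
  comp := GrRing.comp
  indep := GrRing.indep
  span := GrRing.span
  smul_mem := fun ha hm => GrRing.mul_mem ha hm

/-- `A` as an object of `A-gr`, when `A` is idempotent and torsion-free. -/
def UTMod.self (Γ : Type v) [Group Γ] {A : Type u} [NonUnitalRing A] [GrRing Γ A]
    (hA : IsIdempotentRing A) (hA' : IsTorsionFreeRing A) : UTMod Γ A where
  toGrMod := GrMod.self Γ A
  unital := hA
  torsionFree := hA'.1

/-- `P` is a generator of `A-gr`: it generates every object of `A-gr`. -/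
def UTMod.IsGenerator (P : UTMod Γ A) : Prop :=
  ∀ M : UTMod Γ A, GrMod.Generates P.toGrMod M.toGrMod

/-- For `a ∈ A_σ`, right multiplication `x ↦ x a` as a morphism `A → A(σ)` in `A-gr`. -/
def rightMul (hA : IsIdempotentRing A) (hA' : IsTorsionFreeRing A) {σ : Γ} {a : A}
    (ha : a ∈ GrRing.comp σ) :
    UTMod.self Γ hA hA' ⟶ (UTMod.susp σ).obj (UTMod.self Γ hA hA') :=
  UTMod.mkHom (M := UTMod.self Γ hA hA') (N := (UTMod.susp σ).obj (UTMod.self Γ hA hA'))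
    (AddMonoidHom.mulRight a : A →+ A)
    ⟨fun b x => mul_assoc b x a, fun _ _ hm => GrRing.mul_mem (A := A) hm ha⟩

/-- The right `A`-module structure `r` on `F(A)` is the one induced by `F`: an element `a ∈ A_σ`
acts by the image under `F` of right multiplication by `a`, that is, by the composite
`F(A) → F(A(σ)) ≅ F(A)(σ)`, whose target has the same underlying group as `F(A)`.
As `A` is spanned by its homogeneous elements, this determines the structure. -/
def IsInducedBy (F : GradedFunctor Γ A B) (hA : IsIdempotentRing A) (hA' : IsTorsionFreeRing A)
    (r : RightStr A (F.toFunctor.obj (UTMod.self Γ hA hA')).toGrMod) : Prop :=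
  ∀ (σ : Γ) (a : A) (ha : a ∈ GrRing.comp σ) (x : F.toFunctor.obj (UTMod.self Γ hA hA')),
    r.act a x = UTMod.app
      (F.toFunctor.map (rightMul hA hA' ha) ≫ (F.comm σ).hom.app (UTMod.self Γ hA hA')) x

/-! ### Graded Morita contexts -/

open scoped TensorProduct in
/-- `P ⊗_B Q` for a right `B`-module `P` and a left `B`-module `Q`: the quotient of `P ⊗_ℤ Q` by
the subgroup generated by all `p b ⊗ q - p ⊗ b q`. -/
def BalTensor {P : GrMod Γ A} (r : RightStr B P) (Q : GrMod Γ B) : Type u :=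
  (P ⊗[ℤ] Q) ⧸ AddSubgroup.closure
    {x : P ⊗[ℤ] Q | ∃ (p : P) (b : B) (q : Q), x = r.act b p ⊗ₜ[ℤ] q - p ⊗ₜ[ℤ] Q.smul b q}

instance {P : GrMod Γ A} (r : RightStr B P) (Q : GrMod Γ B) : AddCommGroup (BalTensor r Q) :=
  inferInstanceAs (AddCommGroup (_ ⧸ _))

/-- The element `p ⊗ q` of `P ⊗_B Q`. -/
def BalTensor.tmul {P : GrMod Γ A} (r : RightStr B P) {Q : GrMod Γ B} (p : P) (q : Q) :
    BalTensor r Q :=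
  QuotientAddGroup.mk (p ⊗ₜ[ℤ] q)

open BalTensor in
/-- A graded Morita context `(A,B,P,Q,μ,ν)`, where the graded `(A,B)`-bimodule `P` is given with
its right structure `rP`, and the graded `(B,A)`-bimodule `Q` with `rQ`. That the additive maps
`μ : P ⊗_B Q → A` and `ν : Q ⊗_A P → B` are graded bimodule homomorphisms is
expressed on the elements `p ⊗ q` and `q ⊗ p`, which generate the tensor products. -/
structure MoritaContext (P : GrMod Γ A) (rP : RightStr B P) (Q : GrMod Γ B)
    (rQ : RightStr A Q) where
  idempotent_left : IsIdempotentRing A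
  idempotent_right : IsIdempotentRing B
  P_unital : P.IsUnital
  P_unital' : rP.IsUnital
  Q_unital : Q.IsUnital
  Q_unital' : rQ.IsUnital
  μ : BalTensor rP Q →+ A
  ν : BalTensor rQ P →+ B
  μ_smul : ∀ (a : A) (p : P) (q : Q), μ (tmul rP (P.smul a p) q) = a * μ (tmul rP p q)
  μ_act : ∀ (a : A) (p : P) (q : Q), μ (tmul rP p (rQ.act a q)) = μ (tmul rP p q) * a
  μ_mem : ∀ (σ τ : Γ) (p : P) (q : Q), p ∈ P.comp σ → q ∈ Q.comp τ →
    μ (tmul rP p q) ∈ GrRing.comp (σ * τ)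
  ν_smul : ∀ (b : B) (q : Q) (p : P), ν (tmul rQ (Q.smul b q) p) = b * ν (tmul rQ q p)
  ν_act : ∀ (b : B) (q : Q) (p : P), ν (tmul rQ q (rP.act b p)) = ν (tmul rQ q p) * b
  ν_mem : ∀ (σ τ : Γ) (q : Q) (p : P), q ∈ Q.comp σ → p ∈ P.comp τ →
    ν (tmul rQ q p) ∈ GrRing.comp (σ * τ)
  assoc_left : ∀ (p p' : P) (q : Q),
    rP.act (ν (tmul rQ q p)) p' = P.smul (μ (tmul rP p' q)) p
  assoc_right : ∀ (p : P) (q q' : Q),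
    rQ.act (μ (tmul rP p q)) q' = Q.smul (ν (tmul rQ q' p)) q

open BalTensor in
/-- A Morita context is non-degenerate if `P` and `Q` are torsion-free on both sides and the
pairings `μ` and `ν` are faithful in each variable. -/
structure MoritaContext.IsNondegenerate {P : GrMod Γ A} {rP : RightStr B P} {Q : GrMod Γ B}
    {rQ : RightStr A Q} (c : MoritaContext P rP Q rQ) : Prop where
  P_torsionFree : P.IsTorsionFree
  P_torsionFree' : rP.IsTorsionFree
  Q_torsionFree : Q.IsTorsionFree
  Q_torsionFree' : rQ.IsTorsionFree
  μ_left : ∀ p : P, (∀ q : Q, c.μ (tmul rP p q) = 0) → p = 0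
  μ_right : ∀ q : Q, (∀ p : P, c.μ (tmul rP p q) = 0) → q = 0
  ν_left : ∀ q : Q, (∀ p : P, c.ν (tmul rQ q p) = 0) → q = 0
  ν_right : ∀ p : P, (∀ q : Q, c.ν (tmul rQ q p) = 0) → p = 0

end GrMorita

open GrMorita

/-!
The argument never uses infinite coproducts or triangle identities. A graded functor `F` acts not
only on morphisms but on homomorphisms `M → N` of any degree `σ`, by `F(M) → F(N(σ)) ≅ F(N)(σ)`
(`GradedFunctor.mapDeg`). This action is additive and functorial, is bijective when `F` is fully
faithful, and natural graded isomorphisms are natural with respect to it. After this translation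
the suspensions disappear and everything can be computed on elements.

Let `P = G(B)`. Right multiplications in `B` are homomorphisms of the left module `B`, so `G` turns
them into a right action on `P`, and `FG ≅ 1` gives an isomorphism `F(P) ≅ B` that carries the
action of `F` on the right multiplications of `P` back to the right multiplications of `B`
(`Realization`). All statements about `P` follow from this isomorphism and the full faithfulness
of `F`. For unitality on the right, `F` kills the quotient map from `P` to `P / {p | A p ⊆ P B}`,
which lies in `A-gr`; right torsion-freeness and the generator property are obtained by
transporting the maps `a ↦ a p` and `b ↦ b y` along `F`.

A homogeneous `n ∈ F(N)` defines `F(P) ≅ B → F(N)`, `x ↦ x n`, which is the image under `F` of a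
unique homomorphism `P → N`. This gives a map `F(N) → HOM_A(P,N)` (`Realization.eval`), whose
image is `B · HOM_A(P,N)` because every `h : B → F(N)` becomes right multiplication by `h(b)` after
composition with right multiplication by `b`. It is the natural graded isomorphism
`F ≅ B · HOM_A(P,-)`, and for `N = P` it sends the element of `F(P)` corresponding to `b` to the
right multiplication by `b` (`Realization.eval_toB`).

For `Q = F(A)` the pairing `⟨p,q⟩ ∈ A` is the evaluation of the homomorphism `P → A` that belongs
to `q`. The map `p' ↦ ⟨p',q⟩ p` comes from an element of `F(P) ≅ B`, so it is right multiplication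
by an element `[q,p]`, which is unique because `B` acts faithfully on `P`. The axioms of a
Morita context and its non-degeneracy then follow by computing in `P`. The pairing `⟨-,-⟩` is onto
because `P` is a generator (`Realization.closure_pairing`), and `[-,-]` is onto because
`P = A P = ⟨P,Q⟩ P = P [Q,P]` (`Realization.closure_bracket`). Exchanging `F` and `G` gives the
statements about `Q` alone.
-/

namespace GrMorita

/-! ### Internally graded abelian groups -/

section Grading

variable {ι : Type*} {G H : Type*} [AddCommGroup G] [AddCommGroup H] {c : ι → AddSubgroup G}

/-- A property that holds for homogeneous elements and is stable under sums holds everywhere. -/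
@[elab_as_elim]
theorem grading_induction (hs : ⨆ i, c i = ⊤) {p : G → Prop} (x : G)
    (hom : ∀ i, ∀ y ∈ c i, p y) (add : ∀ y z, p y → p z → p (y + z)) (zero : p 0) : p x :=
  AddSubgroup.iSup_induction c (C := p) (x := x) (by rw [hs]; trivial) hom zero add

theorem grading_hom_ext (hs : ⨆ i, c i = ⊤) {f g : G →+ H}
    (h : ∀ i, ∀ x ∈ c i, f x = g x) : f = g :=
  AddMonoidHom.ext fun x => grading_induction hs x h
    (fun y z hy hz => by rw [map_add, map_add, hy, hz]) (by rw [map_zero, map_zero])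

open scoped Classical in
/-- Additive maps on the homogeneous components of `G` extend to an additive map on `G`. -/
theorem exists_grading_extension (hi : iSupIndep c) (hs : ⨆ i, c i = ⊤)
    (φ : ∀ i, c i →+ H) : ∃ f : G →+ H, ∀ i (x : G) (hx : x ∈ c i), f x = φ i ⟨x, hx⟩ := by
  have hinj : Function.Injective (DFinsupp.sumAddHom fun i => (c i).subtype) :=
    hi.dfinsuppSumAddHom_injective
  have hsurj : Function.Surjective (DFinsupp.sumAddHom fun i => (c i).subtype) := fun x =>
    grading_induction hs x
      (fun i y hy => ⟨DFinsupp.single i ⟨y, hy⟩, by simp⟩)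
      (fun y z ⟨y', hy⟩ ⟨z', hz⟩ => ⟨y' + z', by rw [map_add, hy, hz]⟩) ⟨0, map_zero _⟩
  let e := AddEquiv.ofBijective _ ⟨hinj, hsurj⟩
  refine ⟨(DFinsupp.sumAddHom φ).comp e.symm.toAddMonoidHom, fun i x hx => ?_⟩
  have h : e.symm x = DFinsupp.single i ⟨x, hx⟩ :=
    (AddEquiv.symm_apply_eq e).2 (by
      change x = DFinsupp.sumAddHom (fun i => (c i).subtype) (DFinsupp.single i ⟨x, hx⟩)
      simp)
  change DFinsupp.sumAddHom φ (e.symm x) = _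
  rw [h, DFinsupp.sumAddHom_single]

/-- The additive extension to `G` of a family of additive maps on its components. -/
noncomputable def gradingExt (hi : iSupIndep c) (hs : ⨆ i, c i = ⊤) (φ : ∀ i, c i →+ H) :
    G →+ H :=
  (exists_grading_extension hi hs φ).choose

theorem gradingExt_of_mem (hi : iSupIndep c) (hs : ⨆ i, c i = ⊤) (φ : ∀ i, c i →+ H) {i : ι}
    {x : G} (hx : x ∈ c i) : gradingExt hi hs φ x = φ i ⟨x, hx⟩ :=
  (exists_grading_extension hi hs φ).choose_spec i x hx

open scoped Classical in
/-- The projection of `G` onto its component of index `i`, as an endomorphism of `G`. -/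
noncomputable def gradingProj (hi : iSupIndep c) (hs : ⨆ i, c i = ⊤) (i : ι) : G →+ G :=
  gradingExt hi hs fun j => if j = i then (c j).subtype else 0

theorem gradingProj_same (hi : iSupIndep c) (hs : ⨆ i, c i = ⊤) {i : ι} {x : G}
    (hx : x ∈ c i) : gradingProj hi hs i x = x := by
  rw [gradingProj, gradingExt_of_mem hi hs _ hx, if_pos rfl]; rfl

theorem gradingProj_ne (hi : iSupIndep c) (hs : ⨆ i, c i = ⊤) {i j : ι} (hij : j ≠ i) {x : G}
    (hx : x ∈ c j) : gradingProj hi hs i x = 0 := by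
  rw [gradingProj, gradingExt_of_mem hi hs _ hx, if_neg hij]; rfl

theorem gradingProj_mem (hi : iSupIndep c) (hs : ⨆ i, c i = ⊤) (i : ι) (x : G) :
    gradingProj hi hs i x ∈ c i := by
  refine grading_induction hs x (fun j y hy => ?_)
    (fun y z hy hz => by rw [map_add]; exact add_mem hy hz) (by rw [map_zero]; exact zero_mem _)
  by_cases hij : j = i
  · subst hij; rwa [gradingProj_same hi hs hy]
  · rw [gradingProj_ne hi hs hij hy]; exact zero_mem _

/-- An element lies in every subgroup that contains all its homogeneous components. -/
theorem mem_of_gradingProj_mem (hi : iSupIndep c) (hs : ⨆ i, c i = ⊤) (K : AddSubgroup G)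
    {x : G} (h : ∀ i, gradingProj hi hs i x ∈ K) : x ∈ K := by
  have key : x ∈ AddSubgroup.closure {y | ∃ i, y = gradingProj hi hs i x} := by
    clear h
    classical
    -- the components of `x` are indexed by a finite set outside of which they vanish
    suffices ∃ s : Finset ι, x = ∑ i ∈ s, gradingProj hi hs i x by
      obtain ⟨s, hx⟩ := this
      rw [hx]
      exact sum_mem fun i _ => AddSubgroup.subset_closure ⟨i, by rw [← hx]⟩
    suffices ∃ s : Finset ι, ∀ t, s ⊆ t → x = ∑ i ∈ t, gradingProj hi hs i x by
      obtain ⟨s, h⟩ := this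
      exact ⟨s, h s subset_rfl⟩
    refine grading_induction hs x (fun j y hy => ⟨{j}, fun t ht => ?_⟩) ?_ ⟨∅, fun t _ => by simp⟩
    · rw [Finset.sum_eq_single j (fun i _ hij => gradingProj_ne hi hs hij.symm hy)
        (fun hj => absurd (ht (Finset.mem_singleton_self j)) hj), gradingProj_same hi hs hy]
    · rintro y z ⟨s, hy⟩ ⟨s', hz⟩
      refine ⟨s ∪ s', fun t ht => ?_⟩
      simp only [map_add, Finset.sum_add_distrib]
      rw [← hy t (Finset.union_subset_left ht), ← hz t (Finset.union_subset_right ht)]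
  refine (AddSubgroup.closure_le K).2 ?_ key
  rintro _ ⟨i, rfl⟩
  exact h i

theorem eq_zero_of_gradingProj (hi : iSupIndep c) (hs : ⨆ i, c i = ⊤) {x : G}
    (h : ∀ i, gradingProj hi hs i x = 0) : x = 0 :=
  mem_of_gradingProj_mem hi hs ⊥ h

/-- Additive maps that send components to components commute with the projections. -/
theorem map_gradingProj {κ : Type*} {d : κ → AddSubgroup H} (hi : iSupIndep c)
    (hs : ⨆ i, c i = ⊤) (hi' : iSupIndep d) (hs' : ⨆ i, d i = ⊤) (f : G →+ H) {e : ι → κ}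
    (he : Function.Injective e) (hf : ∀ i, ∀ x ∈ c i, f x ∈ d (e i)) (i : ι) (x : G) :
    f (gradingProj hi hs i x) = gradingProj hi' hs' (e i) (f x) := by
  refine grading_induction hs x (fun j y hy => ?_)
    (fun y z hy hz => by simp only [map_add, hy, hz]) (by simp only [map_zero])
  by_cases hij : j = i
  · subst hij; rw [gradingProj_same hi hs hy, gradingProj_same hi' hs' (hf _ _ hy)]
  · rw [gradingProj_ne hi hs hij hy, gradingProj_ne hi' hs' (fun h => hij (he h)) (hf _ _ hy),
      map_zero]

/-- An injective additive map that sends components to components reflects homogeneity. -/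
theorem mem_of_map_mem {κ : Type*} {d : κ → AddSubgroup H} (hi : iSupIndep c)
    (hs : ⨆ i, c i = ⊤) (hi' : iSupIndep d) (hs' : ⨆ i, d i = ⊤) (f : G →+ H)
    (hinj : Function.Injective f) {e : ι → κ}
    (he : Function.Injective e) (hf : ∀ i, ∀ x ∈ c i, f x ∈ d (e i)) {i : ι} {x : G}
    (hx : f x ∈ d (e i)) : x ∈ c i := by
  have h : gradingProj hi hs i x = x := hinj (by
    rw [map_gradingProj hi hs hi' hs' f he hf, gradingProj_same hi' hs' hx])
  exact h ▸ gradingProj_mem hi hs i x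

/-- Subgroups that admit a system of projections are independent. -/
theorem iSupIndep_of_proj (p : ι → G →+ G) (h1 : ∀ i, ∀ x ∈ c i, p i x = x)
    (h2 : ∀ i j, j ≠ i → ∀ x ∈ c j, p i x = 0) : iSupIndep c := by
  rw [iSupIndep_def]
  intro i
  rw [AddSubgroup.disjoint_def]
  intro x hx hx'
  have h : (⨆ j, ⨆ (_ : j ≠ i), c j) ≤ (p i).ker := iSup₂_le fun j hj y hy => h2 i j hj y hy
  exact (h1 i x hx).symm.trans (h hx')

/-- The subgroup generated by the values of a biadditive map that sends homogeneous elements to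
homogeneous elements contains the components of its elements. -/
theorem gradingProj_mem_closure {κ κ' : Type*} {X Y : Type*} [AddCommGroup X]
    [AddCommGroup Y] {cX : κ → AddSubgroup X} {cY : κ' → AddSubgroup Y}
    (hX : ⨆ i, cX i = ⊤) (hY : ⨆ i, cY i = ⊤) (hi : iSupIndep c) (hs : ⨆ i, c i = ⊤)
    (f : X →+ Y →+ G) (hf : ∀ σ τ, ∀ x ∈ cX σ, ∀ y ∈ cY τ, ∃ ρ, f x y ∈ c ρ) (ρ : ι) {z : G}
    (hz : z ∈ AddSubgroup.closure {z | ∃ x y, z = f x y}) :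
    gradingProj hi hs ρ z ∈ AddSubgroup.closure {z | ∃ x y, z = f x y} := by
  refine (AddSubgroup.closure_le ((AddSubgroup.closure {z | ∃ x y, z = f x y}).comap
    (gradingProj hi hs ρ))).2 ?_ hz
  rintro _ ⟨x, y, rfl⟩
  change gradingProj hi hs ρ (f x y) ∈ AddSubgroup.closure {z | ∃ x y, z = f x y}
  refine grading_induction hX x (fun σ x hx => grading_induction hY y (fun τ y hy => ?_)
    (fun y y' h h' => by rw [map_add, map_add]; exact add_mem h h')
    (by rw [map_zero, map_zero]; exact zero_mem _))
    (fun x x' h h' => by rw [map_add, AddMonoidHom.add_apply, map_add]; exact add_mem h h')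
    (by rw [map_zero, AddMonoidHom.zero_apply, map_zero]; exact zero_mem _)
  obtain ⟨κ, hκ⟩ := hf σ τ x hx y hy
  by_cases h : κ = ρ
  · subst h
    rw [gradingProj_same hi hs hκ]
    exact AddSubgroup.subset_closure ⟨x, y, rfl⟩
  · rw [gradingProj_ne hi hs h hκ]
    exact zero_mem _

end Grading

/-! ### The action of a graded functor on homomorphisms of arbitrary degree -/

section MapDeg

variable {Γ : Type v} [Group Γ]
variable {A B : Type u} [NonUnitalRing A] [NonUnitalRing B]
variable [GrRing Γ A] [GrRing Γ B]

/-- A homomorphism `M → N` of degree `σ` as a morphism `M → N(σ)`. -/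
def UTMod.degHom {M N : UTMod Γ A} {σ : Γ} (f : M →+ N)
    (hf : f ∈ GrMod.homDeg M.toGrMod N.toGrMod σ) : M ⟶ (UTMod.susp σ).obj N :=
  UTMod.mkHom (M := M) (N := (UTMod.susp σ).obj N) f hf

theorem UTMod.app_smul {M N : UTMod Γ A} (f : M ⟶ N) (a : A) (m : M) :
    UTMod.app f (M.smul a m) = N.smul a (UTMod.app f m) :=
  f.2.1 a m

theorem UTMod.app_mem {M N : UTMod Γ A} (f : M ⟶ N) {σ : Γ} {m : M} (hm : m ∈ M.comp σ) :
    UTMod.app f m ∈ N.comp σ :=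
  f.2.2 σ m hm

theorem GrMod.comp_mem_homDeg_mul {M N K : GrMod Γ A} {σ τ : Γ} {f : M →+ N} {g : N →+ K}
    (hg : g ∈ homDeg N K τ) (hf : f ∈ homDeg M N σ) : g.comp f ∈ homDeg M K (σ * τ) :=
  ⟨fun a m => by rw [AddMonoidHom.comp_apply, AddMonoidHom.comp_apply, hf.1, hg.1],
    fun ρ m hm => by rw [← mul_assoc]; exact hg.2 _ _ (hf.2 ρ m hm)⟩

theorem GrMod.homDeg_comp_mem {M N K : GrMod Γ A} {σ : Γ} {f : M →+ N} {g : N →+ K}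
    (hg : g ∈ homDeg N K σ) (hf : f ∈ gradedHom M N) : g.comp f ∈ homDeg M K σ :=
  ⟨fun a m => by rw [AddMonoidHom.comp_apply, AddMonoidHom.comp_apply, hf.1, hg.1],
    fun ρ m hm => hg.2 _ _ (hf.2 ρ m hm)⟩

namespace GradedFunctor

/-- The map `F(M) → F(N)` induced by a homomorphism `M → N` of degree `σ`, namely the composite
`F(M) → F(N(σ)) ≅ F(N)(σ)`. -/
def mapDeg (F : GradedFunctor Γ A B) {M N : UTMod Γ A} {σ : Γ} (f : M →+ N)
    (hf : f ∈ GrMod.homDeg M.toGrMod N.toGrMod σ) :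
    F.toFunctor.obj M →+ F.toFunctor.obj N :=
  UTMod.app (M := F.toFunctor.obj M) (N := (UTMod.susp σ).obj (F.toFunctor.obj N))
    (F.toFunctor.map (UTMod.degHom f hf) ≫ (F.comm σ).hom.app N)

variable (F : GradedFunctor Γ A B) {M N K : UTMod Γ A} {σ τ : Γ}

theorem mapDeg_mem (f : M →+ N) (hf : f ∈ GrMod.homDeg M.toGrMod N.toGrMod σ) :
    F.mapDeg f hf ∈
      GrMod.homDeg (F.toFunctor.obj M).toGrMod (F.toFunctor.obj N).toGrMod σ :=
  (F.toFunctor.map (UTMod.degHom f hf) ≫ (F.comm σ).hom.app N).2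

theorem mapDeg_congr {f g : M →+ N} (h : f = g)
    (hf : f ∈ GrMod.homDeg M.toGrMod N.toGrMod σ)
    (hg : g ∈ GrMod.homDeg M.toGrMod N.toGrMod σ) : F.mapDeg f hf = F.mapDeg g hg := by
  subst h; rfl

theorem mapDeg_add {f g : M →+ N} (hf : f ∈ GrMod.homDeg M.toGrMod N.toGrMod σ)
    (hg : g ∈ GrMod.homDeg M.toGrMod N.toGrMod σ) :
    F.mapDeg (f + g) (add_mem hf hg) = F.mapDeg f hf + F.mapDeg g hg := by
  have := F.additive
  have h : UTMod.degHom (f + g) (add_mem hf hg) = UTMod.degHom f hf + UTMod.degHom g hg := rfl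
  unfold mapDeg
  rw [h, F.toFunctor.map_add, Preadditive.add_comp]
  rfl

theorem mapDeg_zero :
    F.mapDeg (0 : M →+ N) (zero_mem (GrMod.homDeg M.toGrMod N.toGrMod σ)) = 0 := by
  have h := F.mapDeg_add (zero_mem (GrMod.homDeg M.toGrMod N.toGrMod σ))
    (zero_mem (GrMod.homDeg M.toGrMod N.toGrMod σ))
  rw [F.mapDeg_congr (add_zero 0) _ (zero_mem _)] at h
  exact left_eq_add.1 h

theorem mapDeg_eq_zero {f : M →+ N} (hf : f ∈ GrMod.homDeg M.toGrMod N.toGrMod σ)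
    (h : f = 0) : F.mapDeg f hf = 0 := by
  subst h; exact F.mapDeg_zero

theorem mapDeg_comp {f : M →+ N} {g : N →+ K}
    (hg : g ∈ GrMod.homDeg N.toGrMod K.toGrMod τ) (hf : f ∈ GrMod.homDeg M.toGrMod N.toGrMod σ) :
    F.mapDeg (g.comp f) (GrMod.comp_mem_homDeg_mul hg hf) =
      (F.mapDeg g hg).comp (F.mapDeg f hf) := by
  have h : UTMod.degHom (g.comp f) (GrMod.comp_mem_homDeg_mul hg hf) =
      UTMod.degHom f hf ≫ (UTMod.susp σ).map (UTMod.degHom g hg) ≫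
        (UTMod.suspMul σ τ).hom.app K := rfl
  have h1 := F.comm_mul σ τ K
  have h2 := (F.comm σ).hom.naturality (UTMod.degHom g hg)
  have h3 : F.toFunctor.map (UTMod.degHom (g.comp f) (GrMod.comp_mem_homDeg_mul hg hf)) ≫
      (F.comm (σ * τ)).hom.app K =
      (F.toFunctor.map (UTMod.degHom f hf) ≫ (F.comm σ).hom.app N) ≫
        (UTMod.susp σ).map (F.toFunctor.map (UTMod.degHom g hg) ≫ (F.comm τ).hom.app K) ≫
        (UTMod.suspMul σ τ).hom.app (F.toFunctor.obj K) := by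
    simp only [Functor.comp_obj, Functor.comp_map] at h2
    rw [h, Functor.map_comp, Functor.map_comp, Category.assoc, Category.assoc, h1,
      reassoc_of% h2, Functor.map_comp, Category.assoc, Category.assoc]
  exact congrArg UTMod.app h3

theorem mapDeg_app_comp {f : M →+ N} {g : N ⟶ K}
    (hf : f ∈ GrMod.homDeg M.toGrMod N.toGrMod σ) :
    F.mapDeg ((UTMod.app g).comp f) (GrMod.comp_mem_homDeg g.2 hf) =
      (UTMod.app (F.toFunctor.map g)).comp (F.mapDeg f hf) := by
  have h : UTMod.degHom ((UTMod.app g).comp f) (GrMod.comp_mem_homDeg g.2 hf) =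
      UTMod.degHom f hf ≫ (UTMod.susp σ).map g := rfl
  have h2 := (F.comm σ).hom.naturality g
  simp only [Functor.comp_obj, Functor.comp_map] at h2
  unfold mapDeg
  rw [h, Functor.map_comp, Category.assoc, h2, ← Category.assoc]
  rfl

/-- The identity map `N(σ) → N`, which has degree `σ`, induces the identification
`F(N(σ)) ≅ F(N)(σ)`. -/
theorem mapDeg_id (N : UTMod Γ A) (σ : Γ) :
    F.mapDeg (M := (UTMod.susp σ).obj N) (N := N) (σ := σ) (AddMonoidHom.id N)
      ⟨fun _ _ => rfl, fun _ _ hm => hm⟩ = UTMod.app ((F.comm σ).hom.app N) := by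
  have h : UTMod.degHom (M := (UTMod.susp σ).obj N) (N := N) (σ := σ) (AddMonoidHom.id N)
      ⟨fun _ _ => rfl, fun _ _ hm => hm⟩ = 𝟙 _ := rfl
  unfold mapDeg
  rw [h, CategoryTheory.Functor.map_id]
  exact congrArg UTMod.app (Category.id_comp _)

theorem mapDeg_injective [F.toFunctor.Faithful] {f g : M →+ N}
    (hf : f ∈ GrMod.homDeg M.toGrMod N.toGrMod σ)
    (hg : g ∈ GrMod.homDeg M.toGrMod N.toGrMod σ) (h : F.mapDeg f hf = F.mapDeg g hg) :
    f = g := by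
  have h1 : F.toFunctor.map (UTMod.degHom f hf) ≫ (F.comm σ).hom.app N =
      F.toFunctor.map (UTMod.degHom g hg) ≫ (F.comm σ).hom.app N := Subtype.ext h
  rw [cancel_mono] at h1
  exact congrArg UTMod.app (F.toFunctor.map_injective h1)

theorem eq_zero_of_mapDeg [F.toFunctor.Faithful] {f : M →+ N}
    (hf : f ∈ GrMod.homDeg M.toGrMod N.toGrMod σ) (h : F.mapDeg f hf = 0) : f = 0 :=
  F.mapDeg_injective hf (zero_mem _) (h.trans F.mapDeg_zero.symm)

theorem exists_mapDeg_eq [F.toFunctor.Full] (g : F.toFunctor.obj M →+ F.toFunctor.obj N)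
    (hg : g ∈ GrMod.homDeg (F.toFunctor.obj M).toGrMod (F.toFunctor.obj N).toGrMod σ) :
    ∃ (f : M →+ N) (hf : f ∈ GrMod.homDeg M.toGrMod N.toGrMod σ), F.mapDeg f hf = g := by
  obtain ⟨f, hf⟩ := F.toFunctor.map_surjective (UTMod.degHom g hg ≫ (F.comm σ).inv.app N)
  refine ⟨UTMod.app (N := (UTMod.susp σ).obj N) f, f.2, ?_⟩
  have h : UTMod.degHom (M := M) (N := N) (UTMod.app (N := (UTMod.susp σ).obj N) f) f.2 = f := rfl
  unfold mapDeg
  rw [h, hf, Category.assoc, ← NatTrans.comp_app, Iso.inv_hom_id, NatTrans.id_app]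
  exact congrArg UTMod.app (Category.comp_id (UTMod.degHom g hg))

end GradedFunctor

/-- A natural graded isomorphism `FG ≅ 1` is natural with respect to homomorphisms of
arbitrary degree. -/
theorem GradedNatIso.app_mapDeg_mapDeg {F : GradedFunctor Γ A B} {G : GradedFunctor Γ B A}
    (γ : GradedNatIso (G.comp F) (GradedFunctor.id Γ B)) {M N : UTMod Γ B} {σ : Γ} {f : M →+ N}
    (hf : f ∈ GrMod.homDeg M.toGrMod N.toGrMod σ) (x : F.toFunctor.obj (G.toFunctor.obj M)) :
    UTMod.app (γ.iso.hom.app N) (F.mapDeg (G.mapDeg f hf) (G.mapDeg_mem f hf) x) =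
      f (UTMod.app (γ.iso.hom.app M) x) := by
  have h1 := γ.comm_susp σ N
  have h2 := γ.iso.hom.naturality (UTMod.degHom f hf)
  have h3 : ((G.comp F).toFunctor.map (UTMod.degHom f hf) ≫ ((G.comp F).comm σ).hom.app N) ≫
      (UTMod.susp σ).map (γ.iso.hom.app N) = γ.iso.hom.app M ≫ UTMod.degHom f hf := by
    rw [Category.assoc, ← h1, ← Category.assoc, h2, Category.assoc]
    exact congrArg (γ.iso.hom.app M ≫ ·) (Category.comp_id _)
  have h4 : F.toFunctor.map (UTMod.degHom (G.mapDeg f hf) (G.mapDeg_mem f hf)) ≫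
      (F.comm σ).hom.app (G.toFunctor.obj N) =
      (G.comp F).toFunctor.map (UTMod.degHom f hf) ≫ ((G.comp F).comm σ).hom.app N := by
    have h5 : UTMod.degHom (G.mapDeg f hf) (G.mapDeg_mem f hf) =
      G.toFunctor.map (UTMod.degHom f hf) ≫ (G.comm σ).hom.app N := rfl
    rw [h5, Functor.map_comp, Category.assoc]
    rfl
  unfold GradedFunctor.mapDeg at *
  rw [← h4] at h3
  exact DFunLike.congr_fun (congrArg UTMod.app h3) x

/-! ### Quotients in `A-gr` -/

namespace GrMod

/-- The projection of a graded module onto its component of degree `σ`. -/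
noncomputable def proj (M : GrMod Γ A) (σ : Γ) : M →+ M := gradingProj M.indep M.span σ

theorem proj_smul (M : GrMod Γ A) {σ : Γ} {a : A} (ha : a ∈ GrRing.comp σ) (τ : Γ) (m : M) :
    M.smul a (M.proj τ m) = M.proj (σ * τ) (M.smul a m) :=
  map_gradingProj M.indep M.span M.indep M.span (M.smul a) (mul_right_injective σ)
    (fun _ _ hm => M.smul_mem ha hm) τ m

/-- For a graded submodule `S` of a unital module `M`, the elements `m` with `A m ⊆ S` are the
kernel of a morphism to an object of `A-gr`: as `A` is idempotent, the quotient by them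
is torsion-free. -/
theorem exists_hom_ker (hA : IsIdempotentRing A) {M : GrMod Γ A} (hM : M.IsUnital)
    (S : AddSubgroup M) (hS : ∀ (a : A) (m : M), m ∈ S → M.smul a m ∈ S)
    (hp : ∀ (σ : Γ) (m : M), m ∈ S → M.proj σ m ∈ S) :
    ∃ (N : UTMod Γ A) (π : M →+ N), π ∈ gradedHom M N.toGrMod ∧
      ∀ m : M, π m = 0 ↔ ∀ a : A, M.smul a m ∈ S := by
  let K : AddSubgroup M := ⨅ a : A, S.comap (M.smul a)
  have memK : ∀ m, m ∈ K ↔ ∀ a : A, M.smul a m ∈ S := fun m => by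
    simp only [K, AddSubgroup.mem_iInf, AddSubgroup.mem_comap]
  have hK : ∀ (a : A) (m : M), m ∈ K → M.smul a m ∈ K := fun a m hm =>
    (memK _).2 fun b => hS b _ ((memK m).1 hm a)
  have hpK : ∀ σ, K ≤ K.comap (M.proj σ) := fun σ m hm => (memK _).2 fun a => by
    refine grading_induction (GrRing.span (Γ := Γ) (A := A)) a (fun τ a ha => ?_)
      (fun a b ha hb => ?_) ?_
    · rw [M.proj_smul ha]; exact hp _ _ ((memK m).1 hm a)
    · rw [map_add, AddMonoidHom.add_apply]; exact add_mem ha hb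
    · rw [map_zero, AddMonoidHom.zero_apply]; exact zero_mem _
  let π : M →+ M ⧸ K := QuotientAddGroup.mk' K
  have hπ : Function.Surjective π := QuotientAddGroup.mk'_surjective K
  let Q : GrMod Γ A :=
    { carrier := M ⧸ K
      smul := AddMonoidHom.mk'
        (fun a => QuotientAddGroup.map K K (M.smul a) (hK a))
        (fun a b => QuotientAddGroup.addMonoidHom_ext K (AddMonoidHom.ext fun m => by
          change π (M.smul (a + b) m) = π (M.smul a m) + π (M.smul b m)
          rw [map_add, AddMonoidHom.add_apply, map_add]))
      mul_smul := fun a b x => by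
        obtain ⟨m, rfl⟩ := hπ x
        exact congrArg π (M.mul_smul a b m)
      comp := fun σ => (M.comp σ).map π
      indep := iSupIndep_of_proj (fun σ => QuotientAddGroup.map K K (M.proj σ) (hpK σ))
        (by
          rintro σ _ ⟨m, hm, rfl⟩
          exact congrArg π (gradingProj_same M.indep M.span hm))
        (by
          rintro σ τ h _ ⟨m, hm, rfl⟩
          exact (congrArg π (gradingProj_ne M.indep M.span h hm)).trans (map_zero π))
      span := by
        rw [← AddSubgroup.map_iSup, M.span, ← AddMonoidHom.range_eq_map]
        exact AddMonoidHom.range_eq_top.2 hπ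
      smul_mem := by
        rintro σ τ a _ ha ⟨m, hm, rfl⟩
        exact ⟨_, M.smul_mem ha hm, rfl⟩ }
  have hsmul : ∀ (a : A) (m : M), Q.smul a (π m) = π (M.smul a m) := fun _ _ => rfl
  refine ⟨⟨Q, ?_, ?_⟩, π, ⟨fun _ _ => rfl, fun τ m hm => ⟨m, hm, rfl⟩⟩,
    fun m => (QuotientAddGroup.eq_zero_iff m).trans (memK m)⟩
  · refine eq_top_iff.2 fun x _ => ?_
    obtain ⟨m, rfl⟩ := hπ x
    have hm : m ∈ AddSubgroup.closure {x : M | ∃ (a : A) (m : M), x = M.smul a m} := by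
      rw [show AddSubgroup.closure {x : M | ∃ (a : A) (m : M), x = M.smul a m} = ⊤ from hM]
      trivial
    have h : AddSubgroup.closure {x : M | ∃ (a : A) (m : M), x = M.smul a m} ≤
        (AddSubgroup.closure {x : Q | ∃ (a : A) (m : Q), x = Q.smul a m}).comap π := by
      rw [AddSubgroup.closure_le]
      rintro _ ⟨a, m, rfl⟩
      exact AddSubgroup.subset_closure ⟨a, π m, rfl⟩
    exact h hm
  · intro x hx
    obtain ⟨m, rfl⟩ := hπ x
    refine (QuotientAddGroup.eq_zero_iff m).2 ((memK m).2 fun c => ?_)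
    have hx' : ∀ a, M.smul a m ∈ K := fun a => (QuotientAddGroup.eq_zero_iff _).1 (hx a)
    have h : AddSubgroup.closure {x : A | ∃ a b : A, x = a * b} ≤ S.comap (M.smul.flip m) := by
      rw [AddSubgroup.closure_le]
      rintro _ ⟨a, b, rfl⟩
      change M.smul (a * b) m ∈ S
      rw [M.mul_smul]
      exact (memK _).1 (hx' b) a
    rw [show AddSubgroup.closure {x : A | ∃ a b : A, x = a * b} = ⊤ from hA] at h
    exact h (AddSubgroup.mem_top c)

end GrMod

end MapDeg

section Realization

variable {Γ : Type v} [Group Γ]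
variable {A B : Type u} [NonUnitalRing A] [NonUnitalRing B]
variable [GrRing Γ A] [GrRing Γ B]

/-! ### Homogeneous elements of unital torsion-free modules -/

namespace GrMod

theorem IsUnital.mem_of_smul {M : GrMod Γ A} (hM : M.IsUnital) (K : AddSubgroup M)
    (h : ∀ (a : A) (m : M), M.smul a m ∈ K) (x : M) : x ∈ K := by
  have h1 : AddSubgroup.closure {x : M | ∃ (a : A) (m : M), x = M.smul a m} ≤ K :=
    (AddSubgroup.closure_le K).2 (by rintro _ ⟨a, m, rfl⟩; exact h a m)
  rw [show AddSubgroup.closure {x : M | ∃ (a : A) (m : M), x = M.smul a m} = ⊤ from hM] at h1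
  exact h1 (AddSubgroup.mem_top x)

end GrMod

/-- The homomorphism `A → M`, `a ↦ a m`. -/
def UTMod.orbit (hA : IsIdempotentRing A) (hA' : IsTorsionFreeRing A) {M : UTMod Γ A} (m : M) :
    UTMod.self Γ hA hA' →+ M :=
  M.smul.flip m

theorem UTMod.orbit_mem (hA : IsIdempotentRing A) (hA' : IsTorsionFreeRing A) {M : UTMod Γ A}
    {σ : Γ} {m : M} (hm : m ∈ M.comp σ) :
    UTMod.orbit hA hA' m ∈ GrMod.homDeg (UTMod.self Γ hA hA').toGrMod M.toGrMod σ :=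
  ⟨fun a x => M.mul_smul a x m, fun _ _ hx => M.smul_mem hx hm⟩

theorem IsIdempotentRing.mem_of_mul (hA : IsIdempotentRing A) (K : AddSubgroup A)
    (h : ∀ a b : A, a * b ∈ K) (x : A) : x ∈ K := by
  have h1 : AddSubgroup.closure {x : A | ∃ a b : A, x = a * b} ≤ K :=
    (AddSubgroup.closure_le K).2 (by rintro _ ⟨a, m, rfl⟩; exact h a m)
  rw [show AddSubgroup.closure {x : A | ∃ a b : A, x = a * b} = ⊤ from hA] at h1
  exact h1 (AddSubgroup.mem_top x)

theorem RightStr.act_homDeg {M : GrMod Γ A} (r : RightStr B M) {σ : Γ} {b : B}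
    (hb : b ∈ GrRing.comp σ) : r.act b ∈ GrMod.homDeg M M σ :=
  ⟨fun a m => r.act_smul a b m, fun _ _ hm => r.act_mem hm hb⟩

/-! ### The right action induced by a graded functor -/

namespace GradedFunctor

variable (F : GradedFunctor Γ A B) (hA : IsIdempotentRing A) (hA' : IsTorsionFreeRing A)

/-- The map of `F(A)` induced by right multiplication by a homogeneous element. -/
noncomputable def actDeg (σ : Γ) : GrRing.comp (Γ := Γ) (A := A) σ →+
    (F.toFunctor.obj (UTMod.self Γ hA hA') →+ F.toFunctor.obj (UTMod.self Γ hA hA')) :=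
  AddMonoidHom.mk'
    (fun a => F.mapDeg (UTMod.orbit hA hA' (M := UTMod.self Γ hA hA') a.1)
      (UTMod.orbit_mem hA hA' a.2))
    (fun a b => (F.mapDeg_congr (map_add (UTMod.self Γ hA hA').smul.flip a.1 b.1) _ _).trans
      (F.mapDeg_add _ _))

/-- The additive extension of the induced action to all elements of `A`. -/
noncomputable def inducedAct : A →+
    (F.toFunctor.obj (UTMod.self Γ hA hA') →+ F.toFunctor.obj (UTMod.self Γ hA hA')) :=
  gradingExt (GrRing.indep (Γ := Γ)) GrRing.span (F.actDeg hA hA')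

theorem inducedAct_of_mem {σ : Γ} {a : A} (ha : a ∈ GrRing.comp σ) :
    F.inducedAct hA hA' a =
      F.mapDeg (UTMod.orbit hA hA' (M := UTMod.self Γ hA hA') a)
        (UTMod.orbit_mem hA hA' ha) :=
  gradingExt_of_mem _ _ _ ha

theorem inducedAct_mul (a b : A) (x : F.toFunctor.obj (UTMod.self Γ hA hA')) :
    F.inducedAct hA hA' (a * b) x = F.inducedAct hA hA' b (F.inducedAct hA hA' a x) := by
  refine grading_induction (GrRing.span (Γ := Γ)) a (fun σ a ha => ?_)
    (fun a c ha hc => by simp only [add_mul, map_add, AddMonoidHom.add_apply, ha, hc])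
    (by simp only [zero_mul, map_zero, AddMonoidHom.zero_apply])
  refine grading_induction (GrRing.span (Γ := Γ)) b (fun τ b hb => ?_)
    (fun b c hb hc => by simp only [mul_add, map_add, AddMonoidHom.add_apply, hb, hc])
    (by simp only [mul_zero, map_zero, AddMonoidHom.zero_apply])
  rw [inducedAct_of_mem F hA hA' ha, inducedAct_of_mem F hA hA' hb,
    inducedAct_of_mem F hA hA' (GrRing.mul_mem ha hb), ← AddMonoidHom.comp_apply,
    ← mapDeg_comp]
  refine DFunLike.congr_fun (F.mapDeg_congr (AddMonoidHom.ext fun y => ?_) _ _) x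
  exact ((UTMod.self Γ hA hA').mul_smul y a b).symm

/-- The right `A`-module structure on `F(A)` induced by right multiplications in `A`. -/
noncomputable def inducedRight :
    RightStr A (F.toFunctor.obj (UTMod.self Γ hA hA')).toGrMod where
  act := F.inducedAct hA hA'
  act_mul := F.inducedAct_mul hA hA'
  act_smul := fun b a x => by
    refine grading_induction (GrRing.span (Γ := Γ)) a (fun σ a ha => ?_)
      (fun a c ha hc => ?_) ?_
    · rw [inducedAct_of_mem F hA hA' ha]; exact (F.mapDeg_mem _ _).1 b x
    · simp only [map_add, AddMonoidHom.add_apply, ha, hc]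
    · simp only [map_zero, AddMonoidHom.zero_apply]
  act_mem := fun {σ τ a x} hx ha => by
    rw [inducedAct_of_mem F hA hA' ha]; exact (F.mapDeg_mem _ _).2 σ x hx

theorem inducedRight_isInducedBy : IsInducedBy F hA hA' (F.inducedRight hA hA') :=
  fun _ _ ha x => DFunLike.congr_fun (F.inducedAct_of_mem hA hA' ha) x

end GradedFunctor

/-! ### Objects that a fully faithful graded functor sends to the ring -/

/-- An isomorphism `e : F(P) ≅ B` in `B-gr` under which the action of `F` on right
multiplications of `P` becomes the right multiplication of `B`. -/
structure Realization (F : GradedFunctor Γ A B) (hB : IsIdempotentRing B)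
    (hB' : IsTorsionFreeRing B) (P : UTMod Γ A) (r : RightStr B P.toGrMod) where
  iso : F.toFunctor.obj P ≅ UTMod.self Γ hB hB'
  map_act : ∀ {σ : Γ} {b : B} (hb : b ∈ GrRing.comp σ) (x : F.toFunctor.obj P),
    (UTMod.app iso.hom (F.mapDeg (r.act b) (r.act_homDeg hb) x) : B) =
      (show B from UTMod.app iso.hom x) * b

/-- The component at `B` of a natural graded isomorphism `FG ≅ 1` realizes `G(B)` with its
induced right action. -/
noncomputable def GradedNatIso.realization {F : GradedFunctor Γ A B} {G : GradedFunctor Γ B A}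
    (γ : GradedNatIso (G.comp F) (GradedFunctor.id Γ B)) (hB : IsIdempotentRing B)
    (hB' : IsTorsionFreeRing B) :
    Realization F hB hB' (G.toFunctor.obj (UTMod.self Γ hB hB')) (G.inducedRight hB hB') where
  iso := γ.iso.app (UTMod.self Γ hB hB')
  map_act := fun {σ b} hb x => by
    have h := F.mapDeg_congr (G.inducedAct_of_mem hB hB' hb)
      ((G.inducedRight hB hB').act_homDeg hb) (G.mapDeg_mem _ _)
    exact (congrArg (fun f => UTMod.app (γ.iso.hom.app (UTMod.self Γ hB hB')) (f x)) h).trans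
      (γ.app_mapDeg_mapDeg (M := UTMod.self Γ hB hB') (N := UTMod.self Γ hB hB')
        (UTMod.orbit_mem hB hB' hb) x)

namespace Realization

variable {F : GradedFunctor Γ A B} {hB : IsIdempotentRing B} {hB' : IsTorsionFreeRing B}
variable {P : UTMod Γ A} {r : RightStr B P.toGrMod} (E : Realization F hB hB' P r)

/-- The isomorphism `F(P) ≅ B` as an additive map. -/
def toB : F.toFunctor.obj P →+ B := UTMod.app E.iso.hom

/-- The inverse isomorphism `B ≅ F(P)` as an additive map. -/
def ofB : B →+ F.toFunctor.obj P := UTMod.app E.iso.inv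

theorem ofB_toB (x : F.toFunctor.obj P) : E.ofB (E.toB x) = x :=
  DFunLike.congr_fun (congrArg UTMod.app E.iso.hom_inv_id) x

theorem toB_ofB (b : B) : E.toB (E.ofB b) = b :=
  DFunLike.congr_fun (congrArg UTMod.app E.iso.inv_hom_id) b

theorem toB_smul (b : B) (x : F.toFunctor.obj P) :
    E.toB ((F.toFunctor.obj P).smul b x) = b * E.toB x :=
  E.iso.hom.2.1 b x

theorem toB_act {σ : Γ} {b : B} (hb : b ∈ GrRing.comp σ) (x : F.toFunctor.obj P) :
    E.toB (F.mapDeg (r.act b) (r.act_homDeg hb) x) = E.toB x * b :=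
  E.map_act hb x

theorem toB_mem {σ : Γ} {x : F.toFunctor.obj P} (hx : x ∈ (F.toFunctor.obj P).comp σ) :
    E.toB x ∈ GrRing.comp σ :=
  E.iso.hom.2.2 σ x hx

/-- A homogeneous `b` that acts as `0` on `P` also acts as `0` on `F(P) ≅ B`. -/
theorem eq_zero_of_act_homogeneous (E : Realization F hB hB' P r)
    {σ : Γ} {b : B} (hb : b ∈ GrRing.comp σ)
    (h : ∀ p : P, r.act b p = 0) : b = 0 := by
  refine hB'.1 b fun c => ?_
  have h1 : r.act b = 0 := AddMonoidHom.ext h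
  have h2 := E.toB_act hb (E.ofB c)
  rw [F.mapDeg_eq_zero _ h1, AddMonoidHom.zero_apply, map_zero, toB_ofB] at h2
  exact h2.symm

/-- The right action of `B` on `P` is faithful. -/
theorem eq_zero_of_act (E : Realization F hB hB' P r) {b : B}
    (h : ∀ p : P, r.act b p = 0) : b = 0 := by
  refine eq_zero_of_gradingProj (GrRing.indep (Γ := Γ)) GrRing.span fun σ =>
    E.eq_zero_of_act_homogeneous (gradingProj_mem _ _ σ b) fun p => ?_
  refine grading_induction P.span p (fun τ p hp => ?_)
    (fun p q hp hq => by rw [map_add, hp, hq, add_zero]) (map_zero _)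
  have h1 := map_gradingProj (GrRing.indep (Γ := Γ)) GrRing.span P.indep P.span (r.act.flip p)
    (mul_right_injective τ) (fun _ _ hb => r.act_mem hp hb) σ b
  exact h1.trans ((congrArg _ (h p)).trans (map_zero _))

theorem eq_of_act (E : Realization F hB hB' P r) {b c : B}
    (h : ∀ p : P, r.act b p = r.act c p) : b = c :=
  sub_eq_zero.1 (E.eq_zero_of_act fun p => by
    rw [map_sub, AddMonoidHom.sub_apply, h, sub_self])

variable [F.toFunctor.Faithful]

/-- The quotient map `π` from `P` to `P / {p | A p ⊆ P B}` vanishes on `P B`. So `F(π)` vanishes on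
the products in `F(P) ≅ B`, which generate `B`, and `π = 0`. -/
theorem isUnital_right (E : Realization F hB hB' P r) (hA : IsIdempotentRing A) : r.IsUnital := by
  obtain ⟨N, π, hπ, hker⟩ := GrMod.exists_hom_ker hA P.unital
    (AddSubgroup.closure {x : P | ∃ (m : P) (b : B), x = r.act.flip m b})
    (fun a m hm => by
      refine (AddSubgroup.closure_le ((AddSubgroup.closure
        {x : P | ∃ (m : P) (b : B), x = r.act.flip m b}).comap (P.smul a))).2 ?_ hm
      rintro _ ⟨m, b, rfl⟩
      exact AddSubgroup.subset_closure ⟨P.smul a m, b, (r.act_smul a b m).symm⟩)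
    (fun σ m hm => gradingProj_mem_closure P.span (GrRing.span (Γ := Γ)) P.indep P.span
      r.act.flip (fun σ τ x hx y hy => ⟨σ * τ, r.act_mem hx hy⟩) σ hm)
  let π' : P ⟶ N := UTMod.mkHom π hπ
  have h1 : ∀ (b : B), π.comp (r.act b) = 0 := fun b => AddMonoidHom.ext fun m =>
    (hker _).2 fun a => AddSubgroup.subset_closure ⟨P.smul a m, b, (r.act_smul a b m).symm⟩
  have h2 : ∀ {σ : Γ} {b : B} (hb : b ∈ GrRing.comp σ) (x : F.toFunctor.obj P),
      UTMod.app (F.toFunctor.map π') (F.mapDeg (r.act b) (r.act_homDeg hb) x) = 0 := by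
    intro σ b hb x
    have h3 := F.mapDeg_app_comp (g := π') (r.act_homDeg hb)
    exact DFunLike.congr_fun (h3.symm.trans (F.mapDeg_eq_zero _ (h1 b))) x
  have h3 : ∀ b : B, UTMod.app (F.toFunctor.map π') (E.ofB b) = 0 := fun b =>
    hB.mem_of_mul ((UTMod.app (F.toFunctor.map π')).comp E.ofB).ker (fun c b => by
      change UTMod.app (F.toFunctor.map π') (E.ofB (c * b)) = 0
      refine grading_induction (GrRing.span (Γ := Γ)) b (fun σ b hb => ?_)
        (fun b d hb hd => by rw [mul_add, map_add, map_add, hb, hd, add_zero])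
        (by rw [mul_zero, map_zero, map_zero])
      rw [← h2 hb (E.ofB c), ← E.ofB_toB (F.mapDeg _ _ _), toB_act E hb, toB_ofB]) b
  have h4 : π' = 0 := F.toFunctor.map_injective (by
    have := F.additive
    rw [F.toFunctor.map_zero]
    exact UTMod.hom_ext fun x => by rw [← E.ofB_toB x]; exact h3 _)
  refine eq_top_iff.2 fun x _ => P.unital.mem_of_smul _ (fun a m => ?_) x
  have h5 := (hker m).1 (DFunLike.congr_fun (congrArg UTMod.app h4) m) a
  refine (AddSubgroup.closure_le _).2 ?_ h5
  rintro _ ⟨m, b, rfl⟩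
  exact AddSubgroup.subset_closure ⟨b, m, rfl⟩

/-- If `p B = 0`, then `A → P`, `a ↦ a p`, is annihilated by all right multiplications of `P`. So
its image under `F` takes values in `{z | z B = 0} = 0` inside `F(P) ≅ B`. -/
theorem isTorsionFree_right (E : Realization F hB hB' P r)
    (hA : IsIdempotentRing A) (hA' : IsTorsionFreeRing A) :
    r.IsTorsionFree := by
  intro m hm
  refine eq_zero_of_gradingProj P.indep P.span fun τ => ?_
  have hp : gradingProj P.indep P.span τ m ∈ P.comp τ := gradingProj_mem _ _ τ m
  have h1 : ∀ {σ : Γ} {b : B}, b ∈ GrRing.comp σ →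
      r.act b (gradingProj P.indep P.span τ m) = 0 := by
    intro σ b hb
    rw [map_gradingProj P.indep P.span P.indep P.span (r.act b) (mul_left_injective σ)
      (fun _ _ hx => r.act_mem hx hb) τ m, hm, map_zero]
  generalize gradingProj P.indep P.span τ m = p at hp h1
  have hρ : UTMod.orbit hA hA' p ∈ GrMod.homDeg (UTMod.self Γ hA hA').toGrMod P.toGrMod τ :=
    UTMod.orbit_mem hA hA' hp
  have h2 : F.mapDeg (UTMod.orbit hA hA' p) hρ = 0 := by
    refine AddMonoidHom.ext fun x => ?_
    have h3 : E.toB (F.mapDeg (UTMod.orbit hA hA' p) hρ x) = 0 := by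
      refine hB'.2 _ fun b => ?_
      refine grading_induction (GrRing.span (Γ := Γ)) b (fun σ b hb => ?_)
        (fun b d hb hd => by rw [mul_add, hb, hd, add_zero]) (mul_zero _)
      rw [← E.toB_act hb, ← AddMonoidHom.comp_apply (F.mapDeg _ _), ← F.mapDeg_comp,
        F.mapDeg_eq_zero _ (AddMonoidHom.ext fun a => ?_), AddMonoidHom.zero_apply, map_zero]
      exact (r.act_smul a b p).trans ((congrArg _ (h1 hb)).trans (map_zero _))
    rw [← E.ofB_toB (F.mapDeg _ _ _), h3, map_zero, AddMonoidHom.zero_apply]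
  have h4 := F.eq_zero_of_mapDeg hρ h2
  exact P.torsionFree p fun a => DFunLike.congr_fun h4 a

/-- A nonzero `F(M) → F(N')` is nonzero on some homogeneous `y`, hence on the image of `b ↦ b y`,
and `F(P) ≅ B → F(M)`, `b ↦ b y`, comes from a homomorphism `P → M`. -/
theorem isGenerator (E : Realization F hB hB' P r) [F.toFunctor.Full]
    (hA : IsIdempotentRing A) : P.IsGenerator := by
  intro M N hN f hf hf0
  -- The test module `N` may have torsion; dividing it out does not kill `f`, as `M` is unital.
  obtain ⟨N', π, hπ, hker⟩ := GrMod.exists_hom_ker hA hN ⊥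
    (fun a m hm => by rw [AddSubgroup.mem_bot] at hm ⊢; rw [hm, map_zero])
    (fun a m hm => by rw [AddSubgroup.mem_bot] at hm ⊢; rw [hm, map_zero])
  let f' : M ⟶ N' := UTMod.mkHom (π.comp f)
    ⟨fun a m => by rw [AddMonoidHom.comp_apply, hf.1, hπ.1]; rfl,
      fun τ m hm => hπ.2 τ _ (hf.2 τ m hm)⟩
  have hf' : f' ≠ 0 := fun h => hf0 <| AddMonoidHom.ext fun m =>
    M.unital.mem_of_smul f.ker (fun a m => by
      rw [AddMonoidHom.mem_ker, hf.1]
      exact (hker (f m)).1 (DFunLike.congr_fun (congrArg UTMod.app h) m) a) m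
  have hF : ∃ (σ : Γ) (y : F.toFunctor.obj M), y ∈ (F.toFunctor.obj M).comp σ ∧
      UTMod.app (F.toFunctor.map f') y ≠ 0 := by
    by_contra! h
    refine hf' (F.toFunctor.map_injective ?_)
    have := F.additive
    rw [F.toFunctor.map_zero]
    exact UTMod.hom_ext fun x => DFunLike.congr_fun
      (grading_hom_ext (g := 0) (F.toFunctor.obj M).span h) x
  obtain ⟨σ, y, hy, hy0⟩ := hF
  have hdeg : (UTMod.orbit hB hB' y).comp (UTMod.app E.iso.hom) ∈
      GrMod.homDeg (F.toFunctor.obj P).toGrMod (F.toFunctor.obj M).toGrMod σ :=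
    GrMod.homDeg_comp_mem (UTMod.orbit_mem hB hB' hy) E.iso.hom.2
  obtain ⟨g, hg, hgF⟩ := F.exists_mapDeg_eq _ hdeg
  -- A homomorphism `P → M` of degree `σ` has degree `1` as a map `P(σ⁻¹) → M`.
  refine ⟨σ⁻¹, g, ⟨hg.1, fun τ m hm => ?_⟩, fun h0 => hy0 ?_⟩
  · have := hg.2 _ _ hm
    rwa [inv_mul_cancel_right] at this
  · have h1 : (UTMod.app f').comp g = 0 := AddMonoidHom.ext fun m =>
      (congrArg π (DFunLike.congr_fun h0 m)).trans (map_zero π)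
    have h2 := (F.mapDeg_app_comp (g := f') hg).symm.trans (F.mapDeg_eq_zero _ h1)
    rw [hgF] at h2
    refine (F.toFunctor.obj N').torsionFree _ fun b => ?_
    rw [← UTMod.app_smul]
    have h3 := DFunLike.congr_fun h2 (E.ofB b)
    have h4 : UTMod.app E.iso.hom (E.ofB b) = b := E.toB_ofB b
    rw [AddMonoidHom.comp_apply, AddMonoidHom.comp_apply, h4] at h3
    exact h3

end Realization

end Realization

section HomIso

variable {Γ : Type v} [Group Γ]
variable {A B : Type u} [NonUnitalRing A] [NonUnitalRing B]
variable [GrRing Γ A] [GrRing Γ B]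

/-! ### The isomorphism of a graded functor with `B · HOM_A(P,-)` -/

/-- A bijective morphism of `A-gr` is an isomorphism: its inverse preserves degrees. -/
noncomputable def UTMod.isoOfBijective {M N : UTMod Γ A} (f : M ⟶ N)
    (hf : Function.Bijective (UTMod.app f)) : M ≅ N where
  hom := f
  inv := UTMod.mkHom (AddEquiv.ofBijective (UTMod.app f) hf).symm.toAddMonoidHom
    ⟨fun a n => hf.1 (by
      rw [UTMod.app_smul]
      exact ((AddEquiv.ofBijective (UTMod.app f) hf).apply_symm_apply _).trans
        (congrArg _ ((AddEquiv.ofBijective (UTMod.app f) hf).apply_symm_apply n).symm)),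
    fun τ n hn => mem_of_map_mem M.indep M.span N.indep N.span (UTMod.app f) hf.1
      Function.injective_id (fun _ _ hx => UTMod.app_mem f hx) (i := τ) (by
        have h := (AddEquiv.ofBijective (UTMod.app f) hf).apply_symm_apply n
        exact (show UTMod.app f _ = n from h).symm ▸ hn)⟩
  hom_inv_id := UTMod.hom_ext fun m =>
    (AddEquiv.ofBijective (UTMod.app f) hf).symm_apply_apply m
  inv_hom_id := UTMod.hom_ext fun m =>
    (AddEquiv.ofBijective (UTMod.app f) hf).apply_symm_apply m

namespace Realization

variable {F : GradedFunctor Γ A B} {hB : IsIdempotentRing B} {hB' : IsTorsionFreeRing B}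
variable {P : UTMod Γ A} {r : RightStr B P.toGrMod} (E : Realization F hB hB' P r)

/-- The homomorphism `F(P) ≅ B → F(N)`, `x ↦ x n`. -/
def orbitMap {N : UTMod Γ A} (n : F.toFunctor.obj N) :
    F.toFunctor.obj P →+ F.toFunctor.obj N :=
  (UTMod.orbit hB hB' n).comp (UTMod.app E.iso.hom)

theorem orbitMap_apply {N : UTMod Γ A} (n : F.toFunctor.obj N) (x : F.toFunctor.obj P) :
    E.orbitMap n x = (F.toFunctor.obj N).smul (E.toB x) n := rfl

theorem orbitMap_mem {N : UTMod Γ A} {σ : Γ} {n : F.toFunctor.obj N}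
    (hn : n ∈ (F.toFunctor.obj N).comp σ) : E.orbitMap n ∈
      GrMod.homDeg (F.toFunctor.obj P).toGrMod (F.toFunctor.obj N).toGrMod σ :=
  GrMod.homDeg_comp_mem (UTMod.orbit_mem hB hB' hn) E.iso.hom.2

theorem orbitMap_add {N : UTMod Γ A} (n n' : F.toFunctor.obj N) :
    E.orbitMap (n + n') = E.orbitMap n + E.orbitMap n' :=
  AddMonoidHom.ext fun x => map_add ((F.toFunctor.obj N).smul (E.toB x)) n n'

theorem eq_zero_of_orbitMap {N : UTMod Γ A} {n : F.toFunctor.obj N} (h : E.orbitMap n = 0) :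
    n = 0 := by
  refine (F.toFunctor.obj N).torsionFree n fun b => ?_
  rw [← E.toB_ofB b, ← orbitMap_apply, h, AddMonoidHom.zero_apply]

variable [F.toFunctor.Faithful] [F.toFunctor.Full]

/-- For `n` homogeneous, the homomorphism `P → N` that `F` sends to `F(P) ≅ B → F(N)`,
`x ↦ x n`. -/
noncomputable def evalDeg (N : UTMod Γ A) (σ : Γ) : (F.toFunctor.obj N).comp σ →+ (P →+ N) :=
  AddMonoidHom.mk'
    (fun n => (F.exists_mapDeg_eq (E.orbitMap n.1) (E.orbitMap_mem n.2)).choose)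
    (fun n n' => by
      have h := fun n : (F.toFunctor.obj N).comp σ =>
        (F.exists_mapDeg_eq (E.orbitMap n.1) (E.orbitMap_mem n.2)).choose_spec
      obtain ⟨h1, h2⟩ := h n
      obtain ⟨h3, h4⟩ := h n'
      obtain ⟨h5, h6⟩ := h (n + n')
      refine F.mapDeg_injective h5 (add_mem h1 h3) ?_
      rw [h6, F.mapDeg_add h1 h3, h2, h4, ← E.orbitMap_add]
      rfl)

/-- The map `F(N) → HOM_A(P,N)`. -/
noncomputable def eval (N : UTMod Γ A) : F.toFunctor.obj N →+ (P →+ N) :=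
  gradingExt (F.toFunctor.obj N).indep (F.toFunctor.obj N).span (E.evalDeg N)

theorem eval_spec {N : UTMod Γ A} {σ : Γ} {n : F.toFunctor.obj N}
    (hn : n ∈ (F.toFunctor.obj N).comp σ) :
    ∃ h : E.eval N n ∈ GrMod.homDeg P.toGrMod N.toGrMod σ,
      F.mapDeg (E.eval N n) h = E.orbitMap n := by
  rw [eval, gradingExt_of_mem _ _ _ hn]
  exact (F.exists_mapDeg_eq (E.orbitMap n) (E.orbitMap_mem hn)).choose_spec

theorem eval_mem {N : UTMod Γ A} {σ : Γ} {n : F.toFunctor.obj N}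
    (hn : n ∈ (F.toFunctor.obj N).comp σ) :
    E.eval N n ∈ GrMod.homDeg P.toGrMod N.toGrMod σ :=
  (E.eval_spec hn).1

theorem mapDeg_eval {N : UTMod Γ A} {σ : Γ} {n : F.toFunctor.obj N}
    (hn : n ∈ (F.toFunctor.obj N).comp σ) :
    F.mapDeg (E.eval N n) (E.eval_mem hn) = E.orbitMap n :=
  (E.eval_spec hn).2

theorem eval_unique {N : UTMod Γ A} {σ : Γ} {n : F.toFunctor.obj N}
    (hn : n ∈ (F.toFunctor.obj N).comp σ) {f : P →+ N}
    (hf : f ∈ GrMod.homDeg P.toGrMod N.toGrMod σ) (h : F.mapDeg f hf = E.orbitMap n) :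
    E.eval N n = f :=
  F.mapDeg_injective (E.eval_mem hn) hf ((E.mapDeg_eval hn).trans h.symm)

/-- If `F` sends `f` to `h`, then it sends `f(- b)` to right multiplication by `h(b)`. -/
theorem eval_ofB {N : UTMod Γ A} {σ τ : Γ} {b : B} (hb : b ∈ GrRing.comp σ) {f : P →+ N}
    (hf : f ∈ GrMod.homDeg P.toGrMod N.toGrMod τ) :
    E.eval N (F.mapDeg f hf (E.ofB b)) = f.comp (r.act b) := by
  have hofB : E.ofB b ∈ (F.toFunctor.obj P).comp σ := UTMod.app_mem E.iso.inv hb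
  refine E.eval_unique ((F.mapDeg_mem f hf).2 _ _ hofB)
    (GrMod.comp_mem_homDeg_mul hf (r.act_homDeg hb)) ?_
  rw [F.mapDeg_comp hf (r.act_homDeg hb)]
  refine AddMonoidHom.ext fun x => ?_
  rw [orbitMap_apply, ← (F.mapDeg_mem f hf).1, AddMonoidHom.comp_apply]
  refine congrArg _ ?_
  rw [← E.ofB_toB (F.mapDeg _ _ x), E.toB_act hb]
  exact UTMod.app_smul E.iso.inv (E.toB x) b

theorem eval_smul {N : UTMod Γ A} (b : B) (n : F.toFunctor.obj N) :
    E.eval N ((F.toFunctor.obj N).smul b n) = (E.eval N n).comp (r.act b) := by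
  refine grading_induction (GrRing.span (Γ := Γ)) b (fun σ b hb => ?_)
    (fun b c hb hc => by
      simp only [map_add, AddMonoidHom.add_apply, hb, hc, AddMonoidHom.comp_add])
    (by simp only [map_zero, AddMonoidHom.zero_apply, AddMonoidHom.comp_zero])
  refine grading_induction (F.toFunctor.obj N).span n (fun τ n hn => ?_)
    (fun b c hb hc => by simp only [map_add, hb, hc, AddMonoidHom.add_comp])
    (by simp only [map_zero, AddMonoidHom.zero_comp])
  rw [← E.eval_ofB hb (E.eval_mem hn), E.mapDeg_eval hn, orbitMap_apply, toB_ofB]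

theorem eval_mem_HOM {N : UTMod Γ A} (n : F.toFunctor.obj N) :
    E.eval N n ∈ GrMod.HOM P.toGrMod N.toGrMod :=
  grading_induction (F.toFunctor.obj N).span n
    (fun _ _ hn => GrMod.IsSumHomDeg.deg _ _ (E.eval_mem hn))
    (fun _ _ hx hy => by rw [map_add]; exact add_mem hx hy)
    (by rw [map_zero]; exact zero_mem _)

/-- The map `F(N) → HOM_A(P,N)`, with values in the graded module `HOM_A(P,N)`. -/
noncomputable def evalHOM (N : UTMod Γ A) :
    F.toFunctor.obj N →+ GrMod.homModule r N.toGrMod :=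
  AddMonoidHom.mk'
    (fun n => (⟨E.eval N n, E.eval_mem_HOM n⟩ : GrMod.HOM P.toGrMod N.toGrMod))
    (fun n n' => Subtype.ext (map_add (E.eval N) n n'))

theorem evalHOM_smul {N : UTMod Γ A} (b : B) (n : F.toFunctor.obj N) :
    E.evalHOM N ((F.toFunctor.obj N).smul b n) =
      (GrMod.homModule r N.toGrMod).smul b (E.evalHOM N n) :=
  Subtype.ext (E.eval_smul b n)

theorem evalHOM_mem {N : UTMod Γ A} (n : F.toFunctor.obj N) :
    E.evalHOM N n ∈ (GrMod.homModule r N.toGrMod).unitalSubgroup :=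
  (F.toFunctor.obj N).unital.mem_of_smul
    ((GrMod.homModule r N.toGrMod).unitalSubgroup.comap (E.evalHOM N))
    (fun b n => by
      rw [AddSubgroup.mem_comap, evalHOM_smul]
      exact GrMod.smul_mem_unitalSubgroup _ _ _) n

theorem eval_injective (N : UTMod Γ A) : Function.Injective (E.eval N) := by
  rw [injective_iff_map_eq_zero]
  intro n hn
  refine eq_zero_of_gradingProj (F.toFunctor.obj N).indep (F.toFunctor.obj N).span fun σ => ?_
  have hp := gradingProj_mem (F.toFunctor.obj N).indep (F.toFunctor.obj N).span σ n
  have h1 := map_gradingProj (F.toFunctor.obj N).indep (F.toFunctor.obj N).span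
    (GrMod.homModule r N.toGrMod).indep (GrMod.homModule r N.toGrMod).span (E.evalHOM N)
    Function.injective_id (fun _ _ hx => E.eval_mem hx) σ n
  have h2 : E.evalHOM N n = 0 := Subtype.ext hn
  rw [h2] at h1
  have h3 : E.eval N (gradingProj (F.toFunctor.obj N).indep (F.toFunctor.obj N).span σ n) = 0 :=
    congrArg Subtype.val (h1.trans (map_zero _))
  generalize gradingProj (F.toFunctor.obj N).indep (F.toFunctor.obj N).span σ n = p at hp h3
  exact E.eq_zero_of_orbitMap ((E.mapDeg_eval hp).symm.trans (F.mapDeg_eq_zero _ h3))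

theorem exists_eval_eq {N : UTMod Γ A} (b : B) {f : P →+ N}
    (hf : f ∈ GrMod.HOM P.toGrMod N.toGrMod) : ∃ n, E.eval N n = f.comp (r.act b) := by
  refine grading_induction (GrRing.span (Γ := Γ)) b (fun σ b hb => ?_) ?_ ?_
  · change GrMod.IsSumHomDeg P.toGrMod N.toGrMod f at hf
    induction hf with
    | zero => exact ⟨0, by rw [map_zero, AddMonoidHom.zero_comp]⟩
    | deg τ f hf => exact ⟨_, E.eval_ofB hb hf⟩
    | add _ _ hf hg =>
      obtain ⟨n, hn⟩ := hf
      obtain ⟨n', hn'⟩ := hg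
      exact ⟨n + n', by rw [map_add, hn, hn', AddMonoidHom.add_comp]⟩
  · rintro b c ⟨n, hn⟩ ⟨n', hn'⟩
    exact ⟨n + n', by rw [map_add, hn, hn', map_add, AddMonoidHom.comp_add]⟩
  · exact ⟨0, by rw [map_zero, map_zero, AddMonoidHom.comp_zero]⟩

variable (hr : r.IsUnital)

/-- The morphism `F(N) → B · HOM_A(P,N)`. -/
noncomputable def evalHom (N : UTMod Γ A) : F.toFunctor.obj N ⟶ homObj hB r hr N.toGrMod :=
  UTMod.mkHom (N := homObj hB r hr N.toGrMod) ((E.evalHOM N).codRestrict _ E.evalHOM_mem)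
    ⟨fun b n => Subtype.ext (E.evalHOM_smul b n), fun _ _ hn => E.eval_mem hn⟩

theorem evalHom_bijective (N : UTMod Γ A) : Function.Bijective (UTMod.app (E.evalHom hr N)) := by
  refine ⟨fun n n' h => E.eval_injective N (congrArg homVal h), fun x => ?_⟩
  obtain ⟨x, hx⟩ := x
  suffices ∃ n, E.evalHOM N n = x from this.imp fun n hn => Subtype.ext hn
  change GrMod.IsSumSmul _ x at hx
  induction hx with
  | zero => exact ⟨0, map_zero _⟩
  | smul b f => exact (E.exists_eval_eq b f.2).imp fun n hn => Subtype.ext hn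
  | add _ _ hx hy =>
    obtain ⟨n, hn⟩ := hx
    obtain ⟨n', hn'⟩ := hy
    exact ⟨n + n', by rw [map_add, hn, hn']⟩

theorem eval_naturality {N N' : UTMod Γ A} (f : N ⟶ N') (n : F.toFunctor.obj N) :
    E.eval N' (UTMod.app (F.toFunctor.map f) n) = (UTMod.app f).comp (E.eval N n) := by
  refine grading_induction (F.toFunctor.obj N).span n (fun τ n hn => ?_)
    (fun b c hb hc => by simp only [map_add, hb, hc, AddMonoidHom.comp_add])
    (by simp only [map_zero, AddMonoidHom.comp_zero])
  refine E.eval_unique (UTMod.app_mem _ hn) (GrMod.comp_mem_homDeg f.2 (E.eval_mem hn)) ?_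
  rw [F.mapDeg_app_comp (E.eval_mem hn), E.mapDeg_eval hn]
  exact AddMonoidHom.ext fun x => UTMod.app_smul _ _ _

theorem eval_mapDeg {N K : UTMod Γ A} {σ : Γ} {f : N →+ K}
    (hf : f ∈ GrMod.homDeg N.toGrMod K.toGrMod σ) (n : F.toFunctor.obj N) :
    E.eval K (F.mapDeg f hf n) = f.comp (E.eval N n) := by
  refine grading_induction (F.toFunctor.obj N).span n (fun τ n hn => ?_)
    (fun b c hb hc => by simp only [map_add, hb, hc, AddMonoidHom.comp_add])
    (by simp only [map_zero, AddMonoidHom.comp_zero])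
  refine E.eval_unique ((F.mapDeg_mem f hf).2 _ _ hn)
    (GrMod.comp_mem_homDeg_mul hf (E.eval_mem hn)) ?_
  rw [F.mapDeg_comp hf (E.eval_mem hn), E.mapDeg_eval hn]
  exact AddMonoidHom.ext fun x => (F.mapDeg_mem f hf).1 _ _

theorem eval_susp (σ : Γ) (N : UTMod Γ A) (n : F.toFunctor.obj ((UTMod.susp σ).obj N)) (p : P) :
    E.eval N (UTMod.app ((F.comm σ).hom.app N) n) p = E.eval ((UTMod.susp σ).obj N) n p := by
  have h := E.eval_mapDeg (N := (UTMod.susp σ).obj N) (K := N) (σ := σ)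
    (f := AddMonoidHom.id N) ⟨fun _ _ => rfl, fun _ _ hm => hm⟩ n
  rw [F.mapDeg_id] at h
  exact DFunLike.congr_fun h p

/-- The natural graded isomorphism `F ≅ B · HOM_A(P,-)`. -/
noncomputable def natIso : GradedNatIso F (homFunctor hB r hr) where
  iso := NatIso.ofComponents (fun N => UTMod.isoOfBijective _ (E.evalHom_bijective hr N))
    (fun {N N'} f => UTMod.hom_ext fun n => by
      refine homVal_ext (hB := hB) (r := r) (hr := hr) (N := N'.toGrMod) fun p => ?_
      exact DFunLike.congr_fun (E.eval_naturality f n) p)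
  comm_susp := fun σ N => UTMod.hom_ext fun n => by
    refine homVal_ext (hB := hB) (r := r) (hr := hr) (N := N.toGrMod) fun p => ?_
    exact (homVal_homSusp hB r hr σ N (UTMod.app (E.evalHom hr _) n) p).trans
      (E.eval_susp σ N n p).symm

/-- Under `F(P) ≅ B · HOM_A(P,P)`, the element of `F(P)` that corresponds to `b` acts on `P` as
right multiplication by `b`. -/
theorem eval_toB (n : F.toFunctor.obj P) : E.eval P n = r.act (E.toB n) := by
  refine grading_induction (F.toFunctor.obj P).span n (fun τ n hn => ?_)
    (fun b c hb hc => by simp only [map_add, hb, hc]) (by simp only [map_zero])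
  refine E.eval_unique hn (r.act_homDeg (E.toB_mem hn)) (AddMonoidHom.ext fun x => ?_)
  rw [orbitMap_apply, ← E.ofB_toB (F.mapDeg _ _ x), E.toB_act (E.toB_mem hn), ← toB_smul,
    ofB_toB]

end Realization

end HomIso

section Morita

variable {Γ : Type v} [Group Γ]
variable {A B : Type u} [NonUnitalRing A] [NonUnitalRing B]
variable [GrRing Γ A] [GrRing Γ B]

/-! ### The Morita context -/

open scoped TensorProduct in
/-- A balanced biadditive map induces an additive map on the balanced tensor product. -/
def BalTensor.lift {P : GrMod Γ A} (r : RightStr B P) {Q : GrMod Γ B} {G : Type*}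
    [AddCommGroup G] (f : P →+ Q →+ G)
    (hf : ∀ (p : P) (b : B) (q : Q), f (r.act b p) q = f p (Q.smul b q)) : BalTensor r Q →+ G :=
  QuotientAddGroup.lift _
    (TensorProduct.liftAddHom f fun n p q => by
      rw [map_zsmul, AddMonoidHom.zsmul_apply, map_zsmul])
    ((AddSubgroup.closure_le _).2 (by
      rintro _ ⟨p, b, q, rfl⟩
      change TensorProduct.liftAddHom f _ (r.act b p ⊗ₜ[ℤ] q - p ⊗ₜ[ℤ] Q.smul b q) = 0
      rw [map_sub, TensorProduct.liftAddHom_tmul, TensorProduct.liftAddHom_tmul, hf, sub_self]))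

namespace Realization

variable {F : GradedFunctor Γ A B} {hB : IsIdempotentRing B} {hB' : IsTorsionFreeRing B}
variable {P : UTMod Γ A} {r : RightStr B P.toGrMod} (E : Realization F hB hB' P r)
variable [F.toFunctor.Faithful] [F.toFunctor.Full]
variable (hA : IsIdempotentRing A) (hA' : IsTorsionFreeRing A)

theorem eval_linear {N : UTMod Γ A} (n : F.toFunctor.obj N) (a : A) (p : P) :
    E.eval N n (P.smul a p) = N.smul a (E.eval N n p) := by
  refine grading_induction (F.toFunctor.obj N).span n (fun τ n hn => (E.eval_mem hn).1 a p)
    (fun x y hx hy => ?_) ?_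
  · rw [map_add, AddMonoidHom.add_apply, AddMonoidHom.add_apply, hx, hy, map_add]
  · rw [map_zero, AddMonoidHom.zero_apply, AddMonoidHom.zero_apply, map_zero]

/-- The pairing `⟨p,q⟩`: evaluation at `p` of the homomorphism `P → A` that corresponds to
`q ∈ F(A)`. -/
noncomputable def pairing : P →+ F.toFunctor.obj (UTMod.self Γ hA hA') →+ A :=
  (E.eval (UTMod.self Γ hA hA')).flip

theorem pairing_smul (a : A) (p : P) (q : F.toFunctor.obj (UTMod.self Γ hA hA')) :
    E.pairing hA hA' (P.smul a p) q = a * E.pairing hA hA' p q :=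
  E.eval_linear q a p

theorem pairing_balanced (p : P) (b : B) (q : F.toFunctor.obj (UTMod.self Γ hA hA')) :
    E.pairing hA hA' (r.act b p) q =
      E.pairing hA hA' p ((F.toFunctor.obj (UTMod.self Γ hA hA')).smul b q) :=
  (DFunLike.congr_fun (E.eval_smul b q) p).symm

theorem pairing_act (a : A) (p : P) (q : F.toFunctor.obj (UTMod.self Γ hA hA')) :
    E.pairing hA hA' p ((F.inducedRight hA hA').act a q) = E.pairing hA hA' p q * a := by
  refine grading_induction (GrRing.span (Γ := Γ)) a (fun σ a ha => ?_)
    (fun a c ha hc => by rw [map_add, AddMonoidHom.add_apply, map_add, ha, hc, mul_add])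
    (by rw [map_zero, AddMonoidHom.zero_apply, map_zero, mul_zero])
  have h := E.eval_mapDeg (UTMod.orbit_mem hA hA' (M := UTMod.self Γ hA hA') ha) q
  rw [← F.inducedAct_of_mem hA hA' ha] at h
  exact DFunLike.congr_fun h p

theorem pairing_mem {σ τ : Γ} {p : P} {q : F.toFunctor.obj (UTMod.self Γ hA hA')}
    (hp : p ∈ P.comp σ) (hq : q ∈ (F.toFunctor.obj (UTMod.self Γ hA hA')).comp τ) :
    E.pairing hA hA' p q ∈ GrRing.comp (σ * τ) :=
  (E.eval_mem hq).2 σ p hp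

theorem eq_of_pairing {q q' : F.toFunctor.obj (UTMod.self Γ hA hA')}
    (h : ∀ p : P, E.pairing hA hA' p q = E.pairing hA hA' p q') : q = q' :=
  E.eval_injective _ (AddMonoidHom.ext h)

/-- For `p` homogeneous, the endomorphism `p' ↦ ⟨p',q⟩ p` of `P` is the composite of `⟨-,q⟩` with
`A → P`, `a ↦ a p`. So it corresponds to an element of `F(P) ≅ B`, and it is the right
multiplication by that element. -/
theorem exists_act_eq_homogeneous {τ : Γ} {p : P} (hp : p ∈ P.comp τ)
    (q : F.toFunctor.obj (UTMod.self Γ hA hA')) :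
    ∃ b : B, (∀ p' : P, r.act b p' = P.smul (E.pairing hA hA' p' q) p) ∧
      ∀ σ, q ∈ (F.toFunctor.obj (UTMod.self Γ hA hA')).comp σ → b ∈ GrRing.comp (σ * τ) := by
  have h := E.eval_mapDeg (UTMod.orbit_mem hA hA' hp) q
  rw [eval_toB] at h
  exact ⟨_, DFunLike.congr_fun h, fun σ hq => E.toB_mem ((F.mapDeg_mem _ _).2 σ q hq)⟩

theorem exists_act_eq (q : F.toFunctor.obj (UTMod.self Γ hA hA')) (p : P) :
    ∃ b : B, ∀ p' : P, r.act b p' = P.smul (E.pairing hA hA' p' q) p := by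
  refine grading_induction P.span p
    (fun τ p hp => (E.exists_act_eq_homogeneous hA hA' hp q).imp fun _ h => h.1) ?_ ?_
  · rintro x y ⟨b, hb⟩ ⟨c, hc⟩
    exact ⟨b + c, fun p' => by rw [map_add, AddMonoidHom.add_apply, hb, hc, map_add]⟩
  · exact ⟨0, fun p' => by rw [map_zero, map_zero, AddMonoidHom.zero_apply]⟩

/-- The pairing `[q,p]`: the unique element of `B` with `p' [q,p] = ⟨p',q⟩ p` for all `p'`. -/
noncomputable def bracket : F.toFunctor.obj (UTMod.self Γ hA hA') →+ P →+ B :=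
  AddMonoidHom.mk'
    (fun q => AddMonoidHom.mk' (fun p => (E.exists_act_eq hA hA' q p).choose)
      (fun p p' => E.eq_of_act fun x => by
        rw [map_add, AddMonoidHom.add_apply, (E.exists_act_eq hA hA' q p).choose_spec,
          (E.exists_act_eq hA hA' q p').choose_spec,
          (E.exists_act_eq hA hA' q (p + p')).choose_spec, map_add]))
    (fun q q' => AddMonoidHom.ext fun p => E.eq_of_act fun x => by
      change r.act (E.exists_act_eq hA hA' (q + q') p).choose x =
        r.act ((E.exists_act_eq hA hA' q p).choose + (E.exists_act_eq hA hA' q' p).choose) x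
      rw [map_add, AddMonoidHom.add_apply, (E.exists_act_eq hA hA' q p).choose_spec,
          (E.exists_act_eq hA hA' q' p).choose_spec,
          (E.exists_act_eq hA hA' (q + q') p).choose_spec, map_add, map_add,
          AddMonoidHom.add_apply])

theorem act_bracket (q : F.toFunctor.obj (UTMod.self Γ hA hA')) (p p' : P) :
    r.act (E.bracket hA hA' q p) p' = P.smul (E.pairing hA hA' p' q) p :=
  (E.exists_act_eq hA hA' q p).choose_spec p'

theorem bracket_smul (b : B) (q : F.toFunctor.obj (UTMod.self Γ hA hA')) (p : P) :
    E.bracket hA hA' ((F.toFunctor.obj (UTMod.self Γ hA hA')).smul b q) p =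
      b * E.bracket hA hA' q p :=
  E.eq_of_act fun x => by
    rw [act_bracket, r.act_mul, act_bracket, pairing_balanced]

theorem bracket_act (b : B) (q : F.toFunctor.obj (UTMod.self Γ hA hA')) (p : P) :
    E.bracket hA hA' q (r.act b p) = E.bracket hA hA' q p * b :=
  E.eq_of_act fun x => by
    rw [act_bracket, r.act_mul, act_bracket, r.act_smul]

theorem bracket_balanced (q : F.toFunctor.obj (UTMod.self Γ hA hA')) (a : A) (p : P) :
    E.bracket hA hA' ((F.inducedRight hA hA').act a q) p =
      E.bracket hA hA' q (P.smul a p) :=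
  E.eq_of_act fun x => by
    rw [act_bracket, act_bracket, pairing_act, P.mul_smul]

theorem bracket_mem {σ τ : Γ} {q : F.toFunctor.obj (UTMod.self Γ hA hA')} {p : P}
    (hq : q ∈ (F.toFunctor.obj (UTMod.self Γ hA hA')).comp σ) (hp : p ∈ P.comp τ) :
    E.bracket hA hA' q p ∈ GrRing.comp (σ * τ) := by
  obtain ⟨b, hb, hb'⟩ := E.exists_act_eq_homogeneous hA hA' hp q
  rw [E.eq_of_act fun x => (E.act_bracket hA hA' q p x).trans (hb x).symm]
  exact hb' σ hq

theorem act_pairing (p : P) (q q' : F.toFunctor.obj (UTMod.self Γ hA hA')) :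
    (F.inducedRight hA hA').act (E.pairing hA hA' p q) q' =
      (F.toFunctor.obj (UTMod.self Γ hA hA')).smul (E.bracket hA hA' q' p) q :=
  E.eq_of_pairing hA hA' fun x => by
    rw [pairing_act, ← pairing_balanced, act_bracket, pairing_smul]

/-- The values `⟨p,q⟩` generate `A`: they contain all values of homomorphisms
`P(σ) → A`, so these would not detect the quotient of `A` by what they generate. -/
theorem closure_pairing (hr : r.IsUnital) :
    AddSubgroup.closure {z | ∃ p q, z = E.pairing hA hA' p q} = ⊤ := by
  set I := AddSubgroup.closure {z | ∃ p q, z = E.pairing hA hA' p q} with hI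
  have hmul : ∀ (a m : A), m ∈ I → a * m ∈ I := fun a m hm => by
    refine (AddSubgroup.closure_le (I.comap (AddMonoidHom.mulLeft a))).2 ?_ hm
    rintro _ ⟨p, q, rfl⟩
    exact AddSubgroup.subset_closure ⟨P.smul a p, q, (E.pairing_smul hA hA' a p q).symm⟩
  obtain ⟨N, π, hπ, hker⟩ := GrMod.exists_hom_ker hA (UTMod.self Γ hA hA').unital I hmul
    (fun σ m hm => gradingProj_mem_closure P.span
      (F.toFunctor.obj (UTMod.self Γ hA hA')).span (UTMod.self Γ hA hA').indep
      (UTMod.self Γ hA hA').span (E.pairing hA hA')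
      (fun σ τ x hx y hy => ⟨σ * τ, E.pairing_mem hA hA' hx hy⟩) σ hm)
  have h0 : π = 0 := by
    by_contra h
    obtain ⟨σ, g, hg, hg0⟩ := E.isGenerator hA (UTMod.self Γ hA hA') N.toGrMod N.unital π hπ h
    have hg' : (show P →+ UTMod.self Γ hA hA' from g) ∈
        GrMod.homDeg P.toGrMod (UTMod.self Γ hA hA').toGrMod σ⁻¹ :=
      ⟨hg.1, fun τ m hm => hg.2 (τ * σ⁻¹) m (by
        change m ∈ P.comp (τ * σ⁻¹ * σ)
        rwa [inv_mul_cancel_right])⟩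
    have h1 : ∀ p : P, g p ∈ I := fun p => by
      have hp : p ∈ AddSubgroup.closure {x : P | ∃ (b : B) (m : P), x = r.act b m} := by
        rw [show AddSubgroup.closure {x : P | ∃ (b : B) (m : P), x = r.act b m} = ⊤ from hr]
        trivial
      refine (AddSubgroup.closure_le
        (I.comap (show P →+ A from g))).2 ?_ hp
      rintro _ ⟨b, m, rfl⟩
      obtain ⟨n, hn⟩ := E.exists_eval_eq b (GrMod.IsSumHomDeg.deg _ _ hg')
      exact AddSubgroup.subset_closure ⟨m, n, (DFunLike.congr_fun hn m).symm⟩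
    exact hg0 (AddMonoidHom.ext fun p => (hker _).2 fun a => hmul a _ (h1 p))
  exact eq_top_iff.2 fun x _ => hA.mem_of_mul I
    (fun a b => (hker b).1 (DFunLike.congr_fun h0 b) a) x

/-- The values `[q,p]` generate `B`: the morphism from `P` that corresponds to the quotient of `B`
by what they generate vanishes on all `p' [q,p] = ⟨p',q⟩ p`, hence on `A P = P`. -/
theorem closure_bracket [F.toFunctor.EssSurj] (hr : r.IsUnital) :
    AddSubgroup.closure {z | ∃ q p, z = E.bracket hA hA' q p} = ⊤ := by
  set J := AddSubgroup.closure {z | ∃ q p, z = E.bracket hA hA' q p} with hJ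
  have hmul : ∀ (b m : B), m ∈ J → b * m ∈ J := fun b m hm => by
    refine (AddSubgroup.closure_le (J.comap (AddMonoidHom.mulLeft b))).2 ?_ hm
    rintro _ ⟨q, p, rfl⟩
    exact AddSubgroup.subset_closure
      ⟨(F.toFunctor.obj (UTMod.self Γ hA hA')).smul b q, p, (E.bracket_smul hA hA' b q p).symm⟩
  obtain ⟨N, π, hπ, hker⟩ := GrMod.exists_hom_ker hB (UTMod.self Γ hB hB').unital J hmul
    (fun σ m hm => gradingProj_mem_closure
      (F.toFunctor.obj (UTMod.self Γ hA hA')).span P.span (UTMod.self Γ hB hB').indep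
      (UTMod.self Γ hB hB').span (E.bracket hA hA')
      (fun σ τ x hx y hy => ⟨σ * τ, E.bracket_mem hA hA' hx hy⟩) σ hm)
  let π' : UTMod.self Γ hB hB' ⟶ N := UTMod.mkHom π hπ
  let i := F.toFunctor.objObjPreimageIso N
  obtain ⟨k, hk⟩ := F.toFunctor.map_surjective (E.iso.hom ≫ π' ≫ i.inv)
  have hk' : ∀ x, UTMod.app (F.toFunctor.map k) x = UTMod.app i.inv (π (E.toB x)) := fun x =>
    DFunLike.congr_fun (congrArg UTMod.app hk) x
  have h1 : ∀ {σ : Γ} {b : B}, b ∈ GrRing.comp σ → b ∈ J → ∀ p, UTMod.app k (r.act b p) = 0 := by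
    intro σ b hb hbJ p
    refine DFunLike.congr_fun (F.eq_zero_of_mapDeg
      (GrMod.comp_mem_homDeg k.2 (r.act_homDeg hb)) ?_) p
    have h2 := F.mapDeg_app_comp (g := k) (r.act_homDeg hb)
    refine h2.trans (AddMonoidHom.ext fun x => ?_)
    have h3 : π (E.toB x * b) = 0 := (hker _).2 fun c => hmul c _ (hmul _ _ hbJ)
    rw [AddMonoidHom.comp_apply, hk', E.toB_act hb, h3, map_zero, AddMonoidHom.zero_apply]
  have h2 : ∀ p' q p, UTMod.app k (P.smul (E.pairing hA hA' p' q) p) = 0 := by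
    intro p' q p
    refine grading_induction P.span p (fun τ p hp => ?_)
      (fun x y hx hy => by rw [map_add, map_add, hx, hy, add_zero])
      (by rw [map_zero, map_zero])
    refine grading_induction (F.toFunctor.obj (UTMod.self Γ hA hA')).span q (fun σ q hq => ?_)
      (fun x y hx hy => by
        rw [map_add, map_add, AddMonoidHom.add_apply, map_add, hx, hy, add_zero])
      (by rw [map_zero, map_zero, AddMonoidHom.zero_apply, map_zero])
    rw [← act_bracket]
    exact h1 (E.bracket_mem hA hA' hq hp) (AddSubgroup.subset_closure ⟨q, p, rfl⟩) p'
  have h3 : ∀ a p, UTMod.app k (P.smul a p) = 0 := fun a p => by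
    have ha : a ∈ AddSubgroup.closure {z | ∃ p q, z = E.pairing hA hA' p q} := by
      rw [E.closure_pairing hA hA' hr]; trivial
    refine (AddSubgroup.closure_le ((UTMod.app k).comp (P.smul.flip p)).ker).2 ?_ ha
    rintro _ ⟨p', q, rfl⟩
    exact h2 p' q p
  have h4 : k = 0 := UTMod.hom_ext fun p =>
    P.unital.mem_of_smul (UTMod.app k).ker h3 p
  have h5 : ∀ b : B, π b = 0 := fun b => by
    have h6 := hk' (E.ofB b)
    have := F.additive
    rw [h4, F.toFunctor.map_zero, toB_ofB] at h6
    have h7 : UTMod.app i.hom (UTMod.app i.inv (π b)) = π b :=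
      DFunLike.congr_fun (congrArg UTMod.app i.inv_hom_id) (π b)
    rw [← h7, ← h6]
    exact map_zero (UTMod.app i.hom)
  exact eq_top_iff.2 fun x _ => hB.mem_of_mul J (fun a b => (hker b).1 (h5 b) a) x

/-- The graded Morita context of `P` and `F(A)`. -/
noncomputable def moritaContext (hr : r.IsUnital)
    (hQ : (F.inducedRight hA hA').IsUnital) :
    MoritaContext P.toGrMod r (F.toFunctor.obj (UTMod.self Γ hA hA')).toGrMod
      (F.inducedRight hA hA') where
  idempotent_left := hA
  idempotent_right := hB
  P_unital := P.unital
  P_unital' := hr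
  Q_unital := (F.toFunctor.obj (UTMod.self Γ hA hA')).unital
  Q_unital' := hQ
  μ := BalTensor.lift r (E.pairing hA hA') (E.pairing_balanced hA hA')
  ν := BalTensor.lift (F.inducedRight hA hA') (E.bracket hA hA') (E.bracket_balanced hA hA')
  μ_smul := E.pairing_smul hA hA'
  μ_act := E.pairing_act hA hA'
  μ_mem := fun _ _ _ _ hp hq => E.pairing_mem hA hA' hp hq
  ν_smul := E.bracket_smul hA hA'
  ν_act := E.bracket_act hA hA'
  ν_mem := fun _ _ _ _ hq hp => E.bracket_mem hA hA' hq hp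
  assoc_left := fun p p' q => E.act_bracket hA hA' q p p'
  assoc_right := E.act_pairing hA hA'

theorem moritaContext_μ_surjective (hr : r.IsUnital) (hQ : (F.inducedRight hA hA').IsUnital) :
    Function.Surjective (E.moritaContext hA hA' hr hQ).μ := by
  refine AddMonoidHom.range_eq_top.1 (eq_top_iff.2 ?_)
  rw [← E.closure_pairing hA hA' hr, AddSubgroup.closure_le]
  rintro _ ⟨p, q, rfl⟩
  exact ⟨BalTensor.tmul r p q, rfl⟩

theorem moritaContext_ν_surjective [F.toFunctor.EssSurj] (hr : r.IsUnital)
    (hQ : (F.inducedRight hA hA').IsUnital) :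
    Function.Surjective (E.moritaContext hA hA' hr hQ).ν := by
  refine AddMonoidHom.range_eq_top.1 (eq_top_iff.2 ?_)
  rw [← E.closure_bracket hA hA' hr, AddSubgroup.closure_le]
  rintro _ ⟨q, p, rfl⟩
  exact ⟨BalTensor.tmul (F.inducedRight hA hA') q p, rfl⟩

theorem eq_zero_of_pairing_smul (hr : r.IsUnital) {p : P}
    (h : ∀ p' q, P.smul (E.pairing hA hA' p' q) p = 0) : p = 0 :=
  P.torsionFree p fun a => by
    have ha : a ∈ AddSubgroup.closure {z | ∃ p q, z = E.pairing hA hA' p q} := by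
      rw [E.closure_pairing hA hA' hr]; trivial
    refine (AddSubgroup.closure_le (P.smul.flip p).ker).2 ?_ ha
    rintro _ ⟨p', q, rfl⟩
    exact h p' q

theorem moritaContext_isNondegenerate [F.toFunctor.EssSurj] (hr : r.IsUnital)
    (hQ : (F.inducedRight hA hA').IsUnital) (hQ' : (F.inducedRight hA hA').IsTorsionFree) :
    (E.moritaContext hA hA' hr hQ).IsNondegenerate where
  P_torsionFree := P.torsionFree
  P_torsionFree' := E.isTorsionFree_right hA hA'
  Q_torsionFree := (F.toFunctor.obj (UTMod.self Γ hA hA')).torsionFree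
  Q_torsionFree' := hQ'
  μ_left := fun p (h : ∀ q, E.pairing hA hA' p q = 0) =>
    E.isTorsionFree_right hA hA' p fun b => by
      have hb : b ∈ AddSubgroup.closure {z | ∃ q p, z = E.bracket hA hA' q p} := by
        rw [E.closure_bracket hA hA' hr]; trivial
      refine (AddSubgroup.closure_le (r.act.flip p).ker).2 ?_ hb
      rintro _ ⟨q, p', rfl⟩
      refine (E.act_bracket hA hA' q p' p).trans ?_
      rw [h, map_zero, AddMonoidHom.zero_apply]
  μ_right := fun q (h : ∀ p, E.pairing hA hA' p q = 0) =>
    E.eq_of_pairing hA hA' fun p => by rw [h, map_zero]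
  ν_left := fun q (h : ∀ p, E.bracket hA hA' q p = 0) => by
    have h1 : ∀ p' p, P.smul (E.pairing hA hA' p' q) p = 0 := fun p' p => by
      rw [← act_bracket, h, map_zero, AddMonoidHom.zero_apply]
    refine E.eq_of_pairing hA hA' fun p' => ?_
    rw [map_zero]
    refine hA'.2 _ fun a => ?_
    have ha : a ∈ AddSubgroup.closure {z | ∃ p q, z = E.pairing hA hA' p q} := by
      rw [E.closure_pairing hA hA' hr]; trivial
    refine (AddSubgroup.closure_le (AddMonoidHom.mulLeft (E.pairing hA hA' p' q)).ker).2 ?_ ha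
    rintro _ ⟨p, q', rfl⟩
    change E.pairing hA hA' p' q * E.pairing hA hA' p q' = 0
    rw [← pairing_smul, h1, map_zero, AddMonoidHom.zero_apply]
  ν_right := fun p (h : ∀ q, E.bracket hA hA' q p = 0) =>
    E.eq_zero_of_pairing_smul hA hA' hr fun p' q => by
      rw [← act_bracket, h, map_zero, AddMonoidHom.zero_apply]

end Realization

end Morita

end GrMorita

open GrMorita
theorem mainTheorem1 {Γ : Type v} [Group Γ] {A B : Type u} [NonUnitalRing A] [NonUnitalRing B]
    [GrRing Γ A] [GrRing Γ B]
    (hA : IsIdempotentRing A) (hA' : IsTorsionFreeRing A)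
    (hB : IsIdempotentRing B) (hB' : IsTorsionFreeRing B)
    (F : GradedFunctor Γ A B) (G : GradedFunctor Γ B A)
    (_η : GradedNatIso (F.comp G) (GradedFunctor.id Γ A))
    (_γ : GradedNatIso (G.comp F) (GradedFunctor.id Γ B)) :
    -- the right structures on `P = G(B)` and `Q = F(A)` induced by the functors
    ∃ (rP : RightStr B (G.toFunctor.obj (UTMod.self Γ hB hB')).toGrMod)
      (rQ : RightStr A (F.toFunctor.obj (UTMod.self Γ hA hA')).toGrMod),
      IsInducedBy G hB hB' rP ∧ IsInducedBy F hA hA' rQ ∧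
      -- `P` and `Q` are unital and torsion-free on the right (and on the left, being
      -- objects of `A-gr` and `B-gr`), and generators on the left
      ∃ (hP : rP.IsUnital) (hQ : rQ.IsUnital),
        rP.IsTorsionFree ∧ rQ.IsTorsionFree ∧
        (G.toFunctor.obj (UTMod.self Γ hB hB')).IsGenerator ∧
        (F.toFunctor.obj (UTMod.self Γ hA hA')).IsGenerator ∧
        -- `G ≅ A · HOM_B(Q,-)` and `F ≅ B · HOM_A(P,-)`
        Nonempty (GradedNatIso G (homFunctor hA rQ hQ)) ∧
        Nonempty (GradedNatIso F (homFunctor hB rP hP)) ∧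
        -- a non-degenerate Morita context with surjective trace maps
        ∃ c : MoritaContext (G.toFunctor.obj (UTMod.self Γ hB hB')).toGrMod rP
            (F.toFunctor.obj (UTMod.self Γ hA hA')).toGrMod rQ,
          Function.Surjective c.μ ∧ Function.Surjective c.ν ∧ c.IsNondegenerate := by
  let e : UTMod Γ A ≌ UTMod Γ B :=
    CategoryTheory.Equivalence.mk F.toFunctor G.toFunctor _η.iso.symm _γ.iso
  have : F.toFunctor.IsEquivalence := e.isEquivalence_functor
  have : G.toFunctor.IsEquivalence := e.isEquivalence_inverse
  let E := _γ.realization hB hB'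
  let E' := _η.realization hA hA'
  have hP : (G.inducedRight hB hB').IsUnital := E.isUnital_right hA
  have hQ : (F.inducedRight hA hA').IsUnital := E'.isUnital_right hB
  have hQ' : (F.inducedRight hA hA').IsTorsionFree := E'.isTorsionFree_right hB hB'
  exact ⟨G.inducedRight hB hB', F.inducedRight hA hA', G.inducedRight_isInducedBy hB hB',
    F.inducedRight_isInducedBy hA hA', hP, hQ, E.isTorsionFree_right hA hA', hQ',
    E.isGenerator hA, E'.isGenerator hB, ⟨E'.natIso hQ⟩, ⟨E.natIso hP⟩,
    E.moritaContext hA hA' hP hQ, E.moritaContext_μ_surjective hA hA' hP hQ,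
    E.moritaContext_ν_surjective hA hA' hP hQ,
    E.moritaContext_isNondegenerate hA hA' hP hQ hQ'⟩
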